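/- **Proposition (Construction of the Picard–Vessiot extension).** A $\sigma\delta$-ring is a commutative ring with a ring automorphism $\sigma$ and a derivation $\delta$ such that $\sigma\delta=\delta\sigma$. For a $\sigma\delta$-field $K$ let $C_K=\{x\in K:\sigma(x)=x\}$ be its field of $\sigma$-constants and let $D_K$ be the relative algebraic closure of $C_K$ in $K$. A $\sigma$-ring (respectively $\sigma\delta$-ring) is *simple* if it is non-zero and has no ideals stable under $\sigma$ (respectively under $\sigma$ and $\delta$) other than $0$ and itself. A *Picard–Vessiot extension* of a $\sigma\delta$-field $K$ for the equation $\sigma(X)=AX$, $A\in GL_m(K)$, is a simple $\sigma\delta$-ring $R$ extending $K$ which contains a fundamental solution $Z\in GL_m(R)$, $\sigma(Z)=AZ$, such that $R=K\{Z,\det(Z)^{-1}\}$, i.e. $R$ is generated as a $\delta$-ring over $K$ by the entries of $Z$ and $\det(Z)^{-1}$. Let $k$ be a $\sigma\delta$-field of characteristic $0$ with $D_k=C_k$, let $m\ge 0$ and $A\in GL_m(k)$. Let $L=k\langle X,\det(X)^{-1}\rangle$ be the $\delta$-field generated over $k$ by an $m\times m$ matrix $X$ of differential indeterminates (that is, all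 the derivatives $X_{ab}^{(j)}$, $j\ge 0$, are algebraically independent over $k$), with $\sigma$ extended from $k$ to $L$ by $\sigma(X)=AX$ and commutativity of $\sigma$ and $\delta$; such a $\sigma\delta$-field $L$ exists. For every such $L$, let $kC_L\subseteq L$ be the field compositum of $k$ and $C_L$, let $R=kC_L\{X,\det(X)^{-1}\}\subseteq L$ and, for $n\ge 0$, let $$K_n=k\big(X,\det(X)^{-1},X',\dots,X^{(n)}\big),\qquad F_n=kC_{K_n}\big[X,\det(X)^{-1},X',\dots,X^{(n)}\big],$$ where $C_{K_n}=\{x\in K_n:\sigma(x)=x\}$. Then: 1. $kC_L$ is a $\sigma\delta$-subfield and $R$ is a $\sigma\delta$-subring of $L$, and $R$ is a Picard–Vessiot extension of $kC_L$ for the equation $\sigma(X)=AX$; 2. $R$ is a simple $\sigma$-ring; 3. each $F_n$ is a $\sigma$-subring of $L$ and is a simple $\sigma$-ring, and $R=\bigcup_{n\ge 0}F_n$. -/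

import Mathlib

universe u v

open scoped Differential

namespace SigmaDelta

/-- A `σδ`-ring: a commutative ring with an automorphism `σ` and a derivation `x ↦ x′`
which commute with each other. -/
class SDRing (R : Type*) [CommRing R] extends Differential R where
  /-- The automorphism `σ`. -/
  sigma : R ≃+* R
  sigma_deriv : ∀ x : R, sigma (x′) = ((sigma x)′)

open SDRing

/-- `R` is an extension of the `σδ`-ring `K`: the structure map commutes with `σ` and with the
derivation. -/
class SDAlgebra (K R : Type*) [CommRing K] [CommRing R] [Algebra K R] [SDRing K] [SDRing R] :
    Prop extends DifferentialAlgebra K R where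
  sigma_algebraMap : ∀ a : K, sigma (algebraMap K R a) = algebraMap K R (sigma a)

/-- A ring with automorphism `σ` is a simple `σ`-ring if it is nonzero and its only `σ`-ideals,
that is, ideals `I` with `σ(I) ⊆ I`, are zero and the whole ring. -/
def IsSimpleSigmaRing {R : Type*} [CommRing R] (σ : R ≃+* R) : Prop :=
  Nontrivial R ∧ ∀ I : Ideal R, (∀ x ∈ I, σ x ∈ I) → I = ⊥ ∨ I = ⊤

/-- A simple `σδ`-ring: nonzero, and its only ideals stable under `σ` and the derivation are zero
and the whole ring. -/
def IsSimpleSDRing (R : Type*) [CommRing R] [SDRing R] : Prop :=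
  Nontrivial R ∧ ∀ I : Ideal R, (∀ x ∈ I, sigma x ∈ I) → (∀ x ∈ I, x′ ∈ I) → I = ⊥ ∨ I = ⊤

/-- The field of `σ`-constants `C_K` of a `σδ`-field `K`. -/
def sigmaConst (K : Type*) [Field K] [SDRing K] : Subfield K where
  carrier := {x | sigma x = x}
  mul_mem' := by
    intro a b ha hb
    simp only [Set.mem_ofPred_eq] at *
    rw [map_mul, ha, hb]
  one_mem' := map_one _
  add_mem' := by
    intro a b ha hb
    simp only [Set.mem_ofPred_eq] at *
    rw [map_add, ha, hb]
  zero_mem' := map_zero _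
  neg_mem' := by
    intro a ha
    simp only [Set.mem_ofPred_eq] at *
    rw [map_neg, ha]
  inv_mem' := by
    intro a ha
    simp only [Set.mem_ofPred_eq] at *
    rw [map_inv₀, ha]

/-- The set `D_K` of elements of `K` that are algebraic over `C_K`. -/
def sigmaConstAlg (K : Type*) [Field K] [SDRing K] : Set K :=
  {x | IsAlgebraic (sigmaConst K) x}

/-- `K{s}`: the smallest `K`-subalgebra of `R` that contains `s` and is stable under the
derivation. -/
def deltaAdjoin (K : Type*) {R : Type*} [CommRing K] [CommRing R] [Algebra K R] [Differential R]
    (s : Set R) : Subalgebra K R :=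
  sInf {S : Subalgebra K R | s ⊆ S ∧ ∀ x ∈ S, x′ ∈ S}

/-- `k⟨s⟩`: the smallest intermediate field of `L / k` that contains `s` and is stable under the
derivation. -/
def deltaFieldAdjoin (k : Type*) {L : Type*} [Field k] [Field L] [Algebra k L] [Differential L]
    (s : Set L) : IntermediateField k L :=
  sInf {S : IntermediateField k L | s ⊆ S ∧ ∀ x ∈ S, x′ ∈ S}

/-- The set of entries of a matrix. -/
def entries {m : ℕ} {R : Type*} (X : Matrix (Fin m) (Fin m) R) : Set R :=
  {x | ∃ a b, x = X a b}

/-- The derivatives `X, X′, …, X⁽ⁿ⁾` of the matrix `X`, as a set of entries. -/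
def jetEntries {m : ℕ} {R : Type*} [CommRing R] [Differential R]
    (X : Matrix (Fin m) (Fin m) R) (n : ℕ) : Set R :=
  {x | ∃ j ≤ n, ∃ a b, x = (fun y : R => y′)^[j] (X a b)}

/-- `R` is a Picard-Vessiot extension of the `σδ`-field `K` for the equation `σ(X) = A X`: it is a
simple `σδ`-ring extending `K` and it is generated over `K`, as a `δ`-ring, by the entries and the
inverse determinant of a fundamental solution `Z ∈ GL_m(R)`. -/
structure IsPicardVessiot (K R : Type*) [Field K] [SDRing K] [CommRing R] [SDRing R] [Algebra K R]
    {m : ℕ} (A : GL (Fin m) K) : Prop where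
  extends_base : SDAlgebra K R
  simple : IsSimpleSDRing R
  exists_fundamental : ∃ Z : GL (Fin m) R,
    Z.val.map sigma = A.val.map (algebraMap K R) * Z.val ∧
      deltaAdjoin K (entries Z.val ∪ {(((Matrix.GeneralLinearGroup.det Z)⁻¹ : Rˣ) : R)}) = ⊤

/-- `L = k⟨X, det(X)⁻¹⟩` for an `m × m` matrix `X` of differential indeterminates over `k`, with
`σ` extending the automorphism of `k` by `σ(X) = A X` and commuting with the derivation. -/
structure IsGenericSolutionField (k L : Type*) [Field k] [SDRing k] [Field L] [SDRing L]
    [Algebra k L] {m : ℕ} (A : GL (Fin m) k) (X : Matrix (Fin m) (Fin m) L) : Prop where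
  extends_base : SDAlgebra k L
  indeterminates : AlgebraicIndependent k
    (fun p : ℕ × Fin m × Fin m => (fun y : L => y′)^[p.1] (X p.2.1 p.2.2))
  generates : deltaFieldAdjoin k (entries X ∪ {(X.det)⁻¹}) = ⊤
  equation : X.map sigma = A.val.map (algebraMap k L) * X

section Restriction

variable {L S : Type*} [CommRing L] [SDRing L] [SetLike S L] [SubringClass S L]

/-- A subring is a `σ`-subring if `σ` restricts to an automorphism of it. -/
def IsSigmaStable (s : S) : Prop :=
  ∀ x ∈ s, sigma x ∈ s ∧ sigma.symm x ∈ s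

/-- A subring is a `σδ`-subring if `σ` restricts to an automorphism of it and it is stable under
the derivation. -/
def IsSDStable (s : S) : Prop :=
  IsSigmaStable s ∧ ∀ x ∈ s, x′ ∈ s

/-- The automorphism induced by `σ` on a `σ`-subring. -/
def restrictSigma (s : S) (h : IsSigmaStable s) : s ≃+* s where
  toFun x := ⟨sigma x.1, (h x.1 x.2).1⟩
  invFun x := ⟨sigma.symm x.1, (h x.1 x.2).2⟩
  left_inv x := by ext; simp
  right_inv x := by ext; simp
  map_mul' x y := by ext; simp
  map_add' x y := by ext; simp

/-- The `σδ`-ring structure induced on a `σδ`-subring. -/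
@[reducible]
def restrictSD (s : S) (h : IsSDStable s) : SDRing s where
  deriv := Derivation.mk'
    (AddMonoidHom.toIntLinearMap
      { toFun := fun x => ⟨x.1′, h.2 x.1 x.2⟩
        map_zero' := by ext; simp
        map_add' := fun x y => by ext; simp })
    (fun x y => by ext; simp)
  sigma := restrictSigma s h.1
  sigma_deriv x := Subtype.ext (sigma_deriv x.1)

end Restriction

section Tower

variable (k : Type*) {L : Type*} [Field k] [Field L] [SDRing L] [Algebra k L] {m : ℕ}
  (X : Matrix (Fin m) (Fin m) L)

/-- For an intermediate field `E` of `L / k`, the compositum `k C_E` in `L`, where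
`C_E = {x ∈ E | σ(x) = x}`. -/
def baseConst {k : Type*} {L : Type*} [Field k] [Field L] [SDRing L] [Algebra k L]
    (E : IntermediateField k L) : IntermediateField k L :=
  IntermediateField.adjoin k {x : L | x ∈ E ∧ sigma x = x}

/-- The field `k C_L`. -/
abbrev kCL (k L : Type*) [Field k] [Field L] [SDRing L] [Algebra k L] : IntermediateField k L :=
  baseConst (⊤ : IntermediateField k L)

/-- The field `K_n = k(X, det(X)⁻¹, X′, …, X⁽ⁿ⁾)`. -/
def jetField (n : ℕ) : IntermediateField k L :=
  IntermediateField.adjoin k (jetEntries X n ∪ {(X.det)⁻¹})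

/-- The ring `F_n = k C_{K_n}[X, det(X)⁻¹, X′, …, X⁽ⁿ⁾]`. -/
def jetRing (n : ℕ) : Subalgebra (baseConst (jetField k X n)) L :=
  Algebra.adjoin (baseConst (jetField k X n)) (jetEntries X n ∪ {(X.det)⁻¹})

/-- The ring `R = k C_L{X, det(X)⁻¹}`. -/
def pvRing : Subalgebra (kCL k L) L :=
  deltaAdjoin (kCL k L) (entries X ∪ {(X.det)⁻¹})

end Tower

end SigmaDelta

/-! ### Constants in tensor products and a criterion for `σ`-simplicity. -/

namespace SigmaDelta
open scoped TensorProduct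

/-! The heart is a simplicity criterion, `sigmaIdeal_eq_bot`. Let `E` be a field with an
endomorphism `σ`, `C` its constants, `C ⊆ K ⊆ E`, and let `F ⊆ E` be generated over `K` by a matrix
`Y` and its inverse, with `σ(Y) = BY` and `B` invertible over `K`. For a proper `σ`-ideal `q` of
`F`, the ring `T = E ⊗_K F/q` receives two maps from `F`: `i` through `E`, and `j` through `F/q`.
Since `i(Y)` and `j(Y)` solve the same equation, `Z = i(Y)⁻¹ j(Y)` is `σ`-fixed. Put `D = C[Z,
Z⁻¹]`. Constants independent over `C` stay independent over `E`, so `F ⊗_C D → T` built from `i` is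
injective. The map built from `j` has the same image because `j(Y) = i(Y)Z`. Comparing the two gives
a surjective endomorphism of the noetherian ring `F ⊗_C D`, which must be injective. Hence `j` is
injective, and `q`, which `j` kills, is zero.

This applies to `F_n` with `E = K_n` and `K = kC_{K_n}`, which have the same constants. The required
matrix comes from iterating `Y ↦ (Y, Y′; 0, Y)`, a multiplicative operation that turns `σ(Y) = BY`
into an equation of the same kind (`exists_prolongation`). Next, `R` is the increasing union of the
`F_n` (`mem_pvRing_iff`), so a proper `σ`-ideal of `R` meets each `F_n` in zero. Simplicity under
`σ` alone implies simplicity under `σ` and `δ`.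

Existence of `L`: derivation and twist are prescribed on differential polynomials and extended to
fractions. -/

theorem linearIndependent_of_sigma_fixed {C E T ι : Type*} [Field C] [Field E] [CommRing T]
    [Algebra C E] [Algebra C T] [Algebra E T] [IsScalarTower C E T]
    (σE : E →+* E) (σT : T →+* T) (hET : ∀ a, σT (algebraMap E T a) = algebraMap E T (σE a))
    (hC : ∀ x, σE x = x → ∃ c, algebraMap C E c = x) {d : ι → T} (hd : ∀ i, σT (d i) = d i)
    (hli : LinearIndependent C d) : LinearIndependent E d := by
  classical
  rw [linearIndependent_iff']
  intro s
  induction s using Finset.induction with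
  | empty => simp
  | insert a s ha ih =>
    intro g hg
    by_cases hga : g a = 0
    · rw [Finset.sum_insert ha, hga, zero_smul, zero_add] at hg
      intro i hi
      rcases Finset.mem_insert.1 hi with rfl | hi
      · exact hga
      · exact ih g hg i hi
    · exfalso
      -- With the coefficient at `a` normalised to 1, subtracting the relation from its image under
      -- `σT` leaves a relation on `s`. By induction that one is trivial, so every `h i` is fixed
      -- and comes from `C`, against independence over `C`.
      set h : ι → E := fun i => (g a)⁻¹ * g i with hh
      have hsum : ∑ i ∈ insert a s, h i • d i = 0 := by
        simp only [hh, mul_smul, ← Finset.smul_sum, hg, smul_zero]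
      have hha : h a = 1 := inv_mul_cancel₀ hga
      have hσ : ∑ i ∈ insert a s, σE (h i) • d i = 0 := by
        have := congrArg σT hsum
        simpa [Algebra.smul_def, hET, hd] using this
      have hsub : ∑ i ∈ s, (σE (h i) - h i) • d i = 0 := by
        rw [Finset.sum_insert ha] at hsum hσ
        simp only [sub_smul, Finset.sum_sub_distrib]
        rw [hha] at hsum hσ
        rw [map_one] at hσ
        linear_combination hσ - hsum
      have hfix : ∀ i ∈ insert a s, ∃ c, algebraMap C E c = h i := by
        intro i hi
        apply hC
        rcases Finset.mem_insert.1 hi with rfl | hi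
        · rw [hha, map_one]
        · exact sub_eq_zero.1 (ih _ hsub i hi)
      choose! c hc using hfix
      have hcsum : ∑ i ∈ insert a s, c i • d i = 0 := by
        rw [← hsum]
        refine Finset.sum_congr rfl fun i hi => ?_
        rw [← hc i hi, algebraMap_smul]
      have h0 := linearIndependent_iff'.1 hli _ _ hcsum a (Finset.mem_insert_self a s)
      have h1 := hc a (Finset.mem_insert_self a s)
      rw [h0, hha, map_zero] at h1
      exact zero_ne_one h1

/-- The kernels of the iterates stabilise at some `n`. Writing an element of `ker f` as `fⁿ(y)` puts
`y` in `ker fⁿ⁺¹ = ker fⁿ`. -/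
theorem injective_of_surjective_ringHom {S : Type*} [CommRing S] [IsNoetherianRing S]
    (f : S →+* S) (hf : Function.Surjective f) : Function.Injective f := by
  have hmono : Monotone fun n : ℕ => RingHom.ker (f ^ n) := by
    refine monotone_nat_of_le_succ fun n x hx => ?_
    rw [RingHom.mem_ker] at hx ⊢
    rw [pow_succ', RingHom.mul_def, RingHom.comp_apply, hx, map_zero]
  obtain ⟨n, hn⟩ := monotone_stabilizes_iff_noetherian.2 ‹IsNoetherianRing S› ⟨_, hmono⟩
  have hsurj : Function.Surjective (f ^ n) := by
    rw [RingHom.coe_pow]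
    exact hf.iterate n
  rw [injective_iff_map_eq_zero]
  intro x hx
  obtain ⟨y, rfl⟩ := hsurj x
  have h1 : y ∈ RingHom.ker (f ^ (n + 1)) := by
    rw [RingHom.mem_ker, pow_succ', RingHom.mul_def, RingHom.comp_apply, hx]
  have h2 : RingHom.ker (f ^ n) = RingHom.ker (f ^ (n + 1)) := hn (n + 1) n.le_succ
  rw [← h2] at h1
  exact h1

theorem adjoin_matrix_induction {K F N : Type*} [CommRing K] [CommRing F] [Algebra K F]
    {Y W : Matrix N N F}
    (hgen : Algebra.adjoin K ({x | ∃ a b, x = Y a b} ∪ {x | ∃ a b, x = W a b}) = ⊤)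
    {T : Type*} [CommRing T] [Algebra K T] (f : F →ₐ[K] T) (P : Subalgebra K T)
    (hY : ∀ a b, f (Y a b) ∈ P) (hW : ∀ a b, f (W a b) ∈ P) (x : F) : f x ∈ P := by
  have : (⊤ : Subalgebra K F) ≤ P.comap f := by
    rw [← hgen, Algebra.adjoin_le_iff]
    rintro x (⟨a, b, rfl⟩ | ⟨a, b, rfl⟩)
    · exact hY a b
    · exact hW a b
  exact this (Algebra.mem_top (x := x))

theorem finite_entries_union {T N : Type*} [Finite N] (Z V : Matrix N N T) :
    ({x | ∃ a b, x = Z a b} ∪ {x | ∃ a b, x = V a b} : Set T).Finite := by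
  have h : ∀ M : Matrix N N T, {x | ∃ a b, x = M a b}.Finite := fun M => by
    refine (Set.finite_range fun p : N × N => M p.1 p.2).subset ?_
    rintro _ ⟨a, b, rfl⟩
    exact ⟨(a, b), rfl⟩
  exact (h Z).union (h V)

section Core

variable {C K E F T N : Type*} [Field C] [Field K] [Field E] [CommRing F] [CommRing T]
  [Algebra C K] [Algebra C E] [Algebra C F] [Algebra C T] [Algebra K E] [Algebra K F]
  [Algebra K T] [Algebra E T] [IsScalarTower C K F] [IsScalarTower C K T]
  [IsScalarTower C E T] [IsScalarTower K E T] [Fintype N] [DecidableEq N]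

/-- The change of variables `j(Y) = i(Y) Z` over a finitely generated algebra of constants `D`
gives a surjective endomorphism of the noetherian ring `F ⊗ D`. -/
theorem injective_of_eq_mul_const [Nontrivial T] (σE : E →+* E) (σT : T →+* T)
    (hET : ∀ a, σT (algebraMap E T a) = algebraMap E T (σE a))
    (hCfix : ∀ c, σE (algebraMap C E c) = algebraMap C E c)
    (hC : ∀ x, σE x = x → ∃ c, algebraMap C E c = x)
    (ι : F →ₐ[K] E) (hι : Function.Injective ι) (j : F →ₐ[K] T)
    {Y W : Matrix N N F} (hWY : W * Y = 1)
    (hgen : Algebra.adjoin K ({x | ∃ a b, x = Y a b} ∪ {x | ∃ a b, x = W a b}) = ⊤)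
    {Z V : Matrix N N T} (hZV : Z * V = 1)
    (hZ : (Y.map fun x => algebraMap E T (ι x)) * Z = Y.map j)
    (hσZ : ∀ a b, σT (Z a b) = Z a b) (hσV : ∀ a b, σT (V a b) = V a b) :
    Function.Injective j := by
  set i : F →ₐ[K] T := (Algebra.algHom K E T).comp ι with hi
  have hia : ∀ x, i x = algebraMap E T (ι x) := fun x => rfl
  have hYW : Y * W = 1 := mul_eq_one_comm.1 hWY
  have hVZ : V * Z = 1 := mul_eq_one_comm.1 hZV
  have hmapmul : ∀ (f : F →ₐ[K] T) (M M' : Matrix N N F), (M * M').map f = M.map f * M'.map f :=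
    fun f M M' => Matrix.map_mul
  have hmapone : ∀ f : F →ₐ[K] T, (1 : Matrix N N F).map f = 1 := fun f =>
    Matrix.map_one f (map_zero f) (map_one f)
  have e1 : Y.map i * Z = Y.map j := hZ
  have e2 : Y.map j * V = Y.map i := by rw [← e1, mul_assoc, hZV, mul_one]
  have e3 : Z * W.map j = W.map i := by
    have : W.map i * (Y.map i * Z) * W.map j = W.map i := by
      rw [e1, mul_assoc, ← hmapmul, hYW, hmapone, mul_one]
    rwa [← mul_assoc, ← hmapmul, hWY, hmapone, one_mul] at this
  have e4 : V * W.map i = W.map j := by rw [← e3, ← mul_assoc, hVZ, one_mul]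
  set D : Subalgebra C T :=
    Algebra.adjoin C ({x | ∃ a b, x = Z a b} ∪ {x | ∃ a b, x = V a b}) with hD
  have hZD : ∀ a b, Z a b ∈ D := fun a b => Algebra.subset_adjoin (Or.inl ⟨a, b, rfl⟩)
  have hVD : ∀ a b, V a b ∈ D := fun a b => Algebra.subset_adjoin (Or.inr ⟨a, b, rfl⟩)
  have hDfix : ∀ x ∈ D, σT x = x := by
    intro x hx
    induction hx using Algebra.adjoin_induction with
    | mem x hx =>
      rcases hx with ⟨a, b, rfl⟩ | ⟨a, b, rfl⟩
      · exact hσZ a b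
      · exact hσV a b
    | algebraMap c => rw [IsScalarTower.algebraMap_apply C E T, hET, hCfix]
    | add x y _ _ hx hy => rw [map_add, hx, hy]
    | mul x y _ _ hx hy => rw [map_mul, hx, hy]
  have hDft : Algebra.FiniteType C D := by
    rw [← Subalgebra.fg_iff_finiteType]
    exact ⟨(finite_entries_union Z V).toFinset, by rw [Set.Finite.coe_toFinset]⟩
  -- Taking only the constants generated by `Z` and `V`, rather than all constants of `T`, keeps `D`
  -- of finite type, so the Hilbert basis theorem applies.
  have hnoeth : IsNoetherianRing (F ⊗[C] D) := by
    have : Algebra.FiniteType K F := ⟨⟨(finite_entries_union Y W).toFinset, by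
      rw [Set.Finite.coe_toFinset, hgen]⟩⟩
    have := Algebra.FiniteType.isNoetherianRing K F
    exact Algebra.FiniteType.isNoetherianRing F _
  let φ₁ : F ⊗[C] D →ₐ[C] T := Algebra.TensorProduct.productMap (i.restrictScalars C) D.val
  let φ₂ : F ⊗[C] D →ₐ[C] T := Algebra.TensorProduct.productMap (j.restrictScalars C) D.val
  -- A `C`-basis of `D` consists of fixed elements, hence is independent over `E`, and `ι` embeds
  -- the coefficients from `F` in `E`.
  have hφ₁ : Function.Injective φ₁ := by
    let b := Module.Basis.ofVectorSpace C D
    have hb : LinearIndependent E fun k => (b k : T) :=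
      linearIndependent_of_sigma_fixed σE σT hET hC (fun k => hDfix _ (b k).2)
        (b.linearIndependent.map' D.val.toLinearMap
          (LinearMap.ker_eq_bot.2 Subtype.val_injective))
    rw [injective_iff_map_eq_zero]
    intro x hx
    obtain ⟨c, rfl⟩ := TensorProduct.eq_repr_basis_right b x
    have : ∑ k ∈ c.support, ι (c k) • (b k : T) = 0 := by
      rw [← hx, Finsupp.sum, map_sum]
      refine Finset.sum_congr rfl fun k _ => ?_
      rw [Algebra.TensorProduct.productMap_apply_tmul, Algebra.smul_def]
      rfl
    have h0 := linearIndependent_iff'.1 hb _ _ this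
    refine Finset.sum_eq_zero fun k hk => ?_
    have : c k = 0 := hι (by rw [h0 k hk, map_zero])
    simp only [this, TensorProduct.zero_tmul]
  have hsub : ∀ (f g : F →ₐ[K] T), (∀ a b, f (Y a b) ∈ (g.restrictScalars C).range ⊔ D) →
      (∀ a b, f (W a b) ∈ (g.restrictScalars C).range ⊔ D) →
      (f.restrictScalars C).range ⊔ D ≤ (g.restrictScalars C).range ⊔ D := by
    intro f g hY hW
    refine sup_le ?_ le_sup_right
    rintro _ ⟨x, rfl⟩
    -- The supremum is a priori only a `C`-subalgebra. It contains the image of `K` because `g` is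
    -- `K`-linear, so it suffices to check the generators of `F` over `K`.
    refine adjoin_matrix_induction hgen f
      { ((g.restrictScalars C).range ⊔ D) with
        algebraMap_mem' := fun r => ?_ } hY hW x
    refine (le_sup_left : (g.restrictScalars C).range ≤ _ ⊔ D) ⟨algebraMap K F r, ?_⟩
    exact g.commutes r
  have hrange : φ₂.range = φ₁.range := by
    have hmemL : ∀ (g : F →ₐ[K] T) x, g x ∈ (g.restrictScalars C).range ⊔ D := fun g x =>
      (le_sup_left : (g.restrictScalars C).range ≤ _ ⊔ D) ⟨x, rfl⟩
    have hmemR : ∀ (g : F →ₐ[K] T) {x}, x ∈ D → x ∈ (g.restrictScalars C).range ⊔ D :=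
      fun g x hx => (le_sup_right : D ≤ (g.restrictScalars C).range ⊔ D) hx
    have hent : ∀ (P : Subalgebra C T) (M M' M'' : Matrix N N T), M * M' = M'' →
        (∀ a b, M a b ∈ P) → (∀ a b, M' a b ∈ P) → ∀ a b, M'' a b ∈ P := by
      rintro P M M' _ rfl h1 h2 a b
      rw [Matrix.mul_apply]
      exact Subalgebra.sum_mem _ fun k _ => P.mul_mem (h1 _ _) (h2 _ _)
    rw [Algebra.TensorProduct.productMap_range, Algebra.TensorProduct.productMap_range,
      Subalgebra.range_val]
    refine le_antisymm (hsub j i ?_ ?_) (hsub i j ?_ ?_)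
    · exact hent _ _ _ _ e1 (fun a b => hmemL i _) (fun a b => hmemR i (hZD a b))
    · exact hent _ _ _ _ e4 (fun a b => hmemR i (hVD a b)) (fun a b => hmemL i _)
    · exact hent _ _ _ _ e2 (fun a b => hmemL j _) (fun a b => hmemR j (hVD a b))
    · exact hent _ _ _ _ e3 (fun a b => hmemR j (hZD a b)) (fun a b => hmemL j _)
  let e := AlgEquiv.ofInjective φ₁ hφ₁
  -- This is `φ₁⁻¹ ∘ φ₂`, well defined and surjective because the two ranges agree.
  let ψ : F ⊗[C] D →ₐ[C] F ⊗[C] D :=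
    (e.symm : φ₁.range →ₐ[C] F ⊗[C] D).comp
      (φ₂.codRestrict φ₁.range fun x => hrange ▸ AlgHom.mem_range_self φ₂ x)
  have hψ : ∀ x, φ₁ (ψ x) = φ₂ x := by
    intro x
    have : e (ψ x) = φ₂.codRestrict φ₁.range (fun x => hrange ▸ AlgHom.mem_range_self φ₂ x) x :=
      e.apply_symm_apply _
    exact congrArg Subtype.val this
  have hψs : Function.Surjective ψ := by
    intro y
    have : φ₁ y ∈ φ₂.range := hrange ▸ AlgHom.mem_range_self φ₁ y
    obtain ⟨x, hx⟩ := this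
    exact ⟨x, hφ₁ ((hψ x).trans hx)⟩
  have hψi : Function.Injective ψ := injective_of_surjective_ringHom ψ.toRingHom hψs
  rw [injective_iff_map_eq_zero]
  intro x hx
  have h1 : ψ (x ⊗ₜ 1) = 0 := by
    apply hφ₁
    rw [hψ, map_zero, Algebra.TensorProduct.productMap_apply_tmul, map_one, mul_one]
    exact hx
  have h2 : (x ⊗ₜ 1 : F ⊗[C] D) = 0 := hψi (h1.trans (map_zero ψ).symm)
  have h3 : i x = 0 := by
    have : φ₁ (x ⊗ₜ 1) = i x := by
      rw [Algebra.TensorProduct.productMap_apply_tmul, map_one, mul_one]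
      rfl
    rw [← this, h2, map_zero]
  rw [hia, map_eq_zero_iff _ (algebraMap E T).injective, map_eq_zero_iff _ hι] at h3
  exact h3

end Core

/-- The semilinear automorphism `σ ⊗ τ` of a tensor product over a ring with endomorphism. -/
noncomputable def tensorSigma {K E Q : Type*} [CommRing K] [CommRing E] [CommRing Q] [Algebra K E]
    [Algebra K Q] (σK : K →+* K) (σE : E →+* E) (σQ : Q →+* Q)
    (hE : ∀ a, σE (algebraMap K E a) = algebraMap K E (σK a))
    (hQ : ∀ a, σQ (algebraMap K Q a) = algebraMap K Q (σK a)) : E ⊗[K] Q →+* E ⊗[K] Q :=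
  let f : E ⊗[K] Q →+ E ⊗[K] Q := TensorProduct.liftAddHom
    (AddMonoidHom.mk' (fun e => AddMonoidHom.mk' (fun q => σE e ⊗ₜ[K] σQ q)
      fun x y => by rw [map_add, TensorProduct.tmul_add])
      fun x y => by ext q; simp [TensorProduct.add_tmul])
    fun r e q => by
      simp [Algebra.smul_def, hE, hQ]
      rw [← Algebra.smul_def, ← Algebra.smul_def, TensorProduct.smul_tmul]
  { f with
    map_one' := by
      change f (1 ⊗ₜ 1) = 1
      simp [f, Algebra.TensorProduct.one_def]
    map_mul' := by
      intro x y
      change f (x * y) = f x * f y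
      induction x with
      | zero => simp
      | add x₁ x₂ h1 h2 => rw [add_mul, map_add, h1, h2, map_add, add_mul]
      | tmul e q =>
        induction y with
        | zero => simp
        | add x₁ x₂ h1 h2 => rw [mul_add, map_add, h1, h2, map_add, mul_add]
        | tmul e' q' => simp [f] }

theorem tensorSigma_tmul {K E Q : Type*} [CommRing K] [CommRing E] [CommRing Q] [Algebra K E]
    [Algebra K Q] (σK : K →+* K) (σE : E →+* E) (σQ : Q →+* Q)
    (hE : ∀ a, σE (algebraMap K E a) = algebraMap K E (σK a))
    (hQ : ∀ a, σQ (algebraMap K Q a) = algebraMap K Q (σK a)) (e : E) (q : Q) :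
    tensorSigma σK σE σQ hE hQ (e ⊗ₜ q) = σE e ⊗ₜ σQ q := rfl

/-- If the constants of a field `E` with endomorphism lie in `K`, then a subring `F` generated over
`K` by a fundamental matrix of a linear difference equation and its inverse is simple. -/
theorem sigmaIdeal_eq_bot {C K E F N : Type*} [Field C] [Field K] [Field E] [CommRing F]
    [Algebra C K] [Algebra C E] [Algebra C F] [Algebra K E] [Algebra K F]
    [IsScalarTower C K E] [IsScalarTower C K F] [Fintype N] [DecidableEq N]
    (σK : K →+* K) (σE : E →+* E) (σF : F →+* F)
    (hKE : ∀ a, σE (algebraMap K E a) = algebraMap K E (σK a))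
    (hKF : ∀ a, σF (algebraMap K F a) = algebraMap K F (σK a))
    (hCfix : ∀ c, σE (algebraMap C E c) = algebraMap C E c)
    (hC : ∀ x, σE x = x → ∃ c, algebraMap C E c = x)
    (ι : F →ₐ[K] E) (hι : Function.Injective ι) (hισ : ∀ x, σE (ι x) = ι (σF x))
    {Y W : Matrix N N F} (hWY : W * Y = 1)
    (hgen : Algebra.adjoin K ({x | ∃ a b, x = Y a b} ∪ {x | ∃ a b, x = W a b}) = ⊤)
    {B B' : Matrix N N F} (hBB : B' * B = 1) (hB : Y.map σF = B * Y)
    (hBK' : ∀ a b, ∃ c, algebraMap K F c = B' a b)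
    (q : Ideal F) (hq : ∀ x ∈ q, σF x ∈ q) (hq1 : q ≠ ⊤) : q = ⊥ := by
  have : Nontrivial (F ⧸ q) := Ideal.Quotient.nontrivial_iff.2 hq1
  have hYW : Y * W = 1 := mul_eq_one_comm.1 hWY
  have hBB2 : B * B' = 1 := mul_eq_one_comm.1 hBB
  have hWσ : W.map σF = W * B' := by
    have h1 : W.map σF * (B * Y) = 1 := by
      rw [← hB, ← Matrix.map_mul, hWY, Matrix.map_one σF (map_zero σF) (map_one σF)]
    calc W.map σF = W.map σF * (B * (Y * W) * B') := by rw [hYW, mul_one, hBB2, mul_one]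
      _ = W.map σF * (B * Y) * (W * B') := by simp only [mul_assoc]
      _ = W * B' := by rw [h1, one_mul]
  let σQ : F ⧸ q →+* F ⧸ q := Ideal.quotientMap q σF hq
  have hσQ : ∀ x, σQ (Ideal.Quotient.mk q x) = Ideal.Quotient.mk q (σF x) := fun x => rfl
  have hKQ : ∀ a, σQ (algebraMap K (F ⧸ q) a) = algebraMap K (F ⧸ q) (σK a) := by
    intro a
    rw [IsScalarTower.algebraMap_apply K F (F ⧸ q), IsScalarTower.algebraMap_apply K F (F ⧸ q),
      Ideal.Quotient.algebraMap_eq, hσQ, hKF]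
  -- `T` is nonzero as a tensor product of nonzero algebras over a field; this is where `q ≠ ⊤`
  -- enters.
  let T := E ⊗[K] (F ⧸ q)
  let σT : T →+* T := tensorSigma σK σE σQ hKE hKQ
  let i : F →ₐ[K] T := (Algebra.algHom K E T).comp ι
  let j : F →ₐ[K] T := (Algebra.TensorProduct.includeRight : F ⧸ q →ₐ[K] T).comp
    (Ideal.Quotient.mkₐ K q)
  have hET : ∀ a, σT (algebraMap E T a) = algebraMap E T (σE a) := by
    intro a
    change tensorSigma σK σE σQ hKE hKQ (a ⊗ₜ 1) = σE a ⊗ₜ 1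
    rw [tensorSigma_tmul, map_one]
  have hiσ : ∀ x, σT (i x) = i (σF x) := fun x => (hET (ι x)).trans (by rw [hισ]; rfl)
  have hjσ : ∀ x, σT (j x) = j (σF x) := fun x => by
    change σT (1 ⊗ₜ _) = 1 ⊗ₜ _
    rw [tensorSigma_tmul, map_one]
    rfl
  have hij : ∀ M : Matrix N N F, (∀ a b, ∃ c, algebraMap K F c = M a b) → M.map i = M.map j := by
    intro M hM
    ext a b
    obtain ⟨c, hc⟩ := hM a b
    rw [Matrix.map_apply, Matrix.map_apply, ← hc, i.commutes, j.commutes]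
  have hiM : ∀ M : Matrix N N F, (M.map i).map σT = (M.map σF).map i := fun M => by
    ext a b; exact hiσ _
  have hjM : ∀ M : Matrix N N F, (M.map j).map σT = (M.map σF).map j := fun M => by
    ext a b; exact hjσ _
  have hmi : ∀ M M' : Matrix N N F, (M * M').map i = M.map i * M'.map i := fun M M' =>
    Matrix.map_mul
  have hmj : ∀ M M' : Matrix N N F, (M * M').map j = M.map j * M'.map j := fun M M' =>
    Matrix.map_mul
  have h1i : (1 : Matrix N N F).map i = 1 := Matrix.map_one i (map_zero i) (map_one i)
  have h1j : (1 : Matrix N N F).map j = 1 := Matrix.map_one j (map_zero j) (map_one j)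
  -- Here `i` and `j` agree on matrices over `K`, so in `σ(Z) = i(Y)⁻¹ i(B)⁻¹ j(B) j(Y)` the middle
  -- factors cancel; likewise for the inverse of `Z`.
  have hjinj : Function.Injective j := by
    refine injective_of_eq_mul_const σE σT hET hCfix hC ι hι j hWY hgen
      (Z := W.map i * Y.map j) (V := W.map j * Y.map i) ?_ ?_ ?_ ?_
    · rw [mul_assoc, ← mul_assoc (Y.map j), ← hmj, hYW, h1j, one_mul, ← hmi, hWY, h1i]
    · change Y.map i * _ = _
      rw [← mul_assoc, ← hmi, hYW, h1i, one_mul]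
    · have : (W.map i * Y.map j).map σT = W.map i * Y.map j := by
        rw [Matrix.map_mul, hiM, hjM, hWσ, hB, hmi, hmj, hij _ hBK', mul_assoc,
          ← mul_assoc (B'.map j), ← hmj, hBB, h1j, one_mul]
      exact fun a b => congrFun (congrFun this a) b
    · have : (W.map j * Y.map i).map σT = W.map j * Y.map i := by
        rw [Matrix.map_mul, hiM, hjM, hWσ, hB, hmi, hmj, ← hij _ hBK', mul_assoc,
          ← mul_assoc (B'.map i), ← hmi, hBB, h1i, one_mul]
      exact fun a b => congrFun (congrFun this a) b
  rw [eq_bot_iff]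
  intro x hx
  have : j x = 0 := by
    change (1 : E) ⊗ₜ[K] (Ideal.Quotient.mk q x) = 0
    rw [Ideal.Quotient.eq_zero_iff_mem.2 hx, TensorProduct.tmul_zero]
  exact (map_eq_zero_iff j hjinj).1 this

end SigmaDelta

/-! ### Jets of a fundamental matrix and the prolonged difference equation. -/

namespace SigmaDelta
open SDRing

section Matrices

theorem det_mem {R N S : Type*} [CommRing R] [Fintype N] [DecidableEq N] [SetLike S R]
    [SubringClass S R] {P : S} {M : Matrix N N R} (hM : ∀ a b, M a b ∈ P) : M.det ∈ P := by
  rw [Matrix.det_apply]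
  exact sum_mem fun σ _ => by
    rw [Units.smul_def]
    exact zsmul_mem (prod_mem fun i _ => hM _ _) _

theorem inv_apply_mem {R N S : Type*} [Field R] [Fintype N] [DecidableEq N] [SetLike S R]
    [SubringClass S R] {P : S} {M : Matrix N N R} (hM : ∀ a b, M a b ∈ P) (hd : (M.det)⁻¹ ∈ P)
    (a b : N) : M⁻¹ a b ∈ P := by
  rw [Matrix.inv_def, Matrix.smul_apply, smul_eq_mul, Ring.inverse_eq_inv', Matrix.adjugate_apply]
  refine mul_mem hd (det_mem fun c d => ?_)
  rw [Matrix.updateRow_apply]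
  split_ifs
  · rw [Pi.single_apply]
    split_ifs
    · exact one_mem P
    · exact zero_mem P
  · exact hM c d

theorem map_deriv_mul {R N : Type*} [CommRing R] [Differential R] [Fintype N]
    (M M' : Matrix N N R) : (M * M').map (fun y => y′) =
      M.map (fun y => y′) * M' + M * M'.map (fun y => y′) := by
  ext a b
  simp only [Matrix.map_apply, Matrix.mul_apply, Matrix.add_apply, map_sum, Derivation.leibniz,
    smul_eq_mul, Finset.sum_add_distrib]
  rw [add_comm]
  congr 1
  exact Finset.sum_congr rfl fun _ _ => mul_comm _ _

/-- By the Leibniz rule the block construction is multiplicative, being a matrix form of `M + M′ε`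
with `ε² = 0`. It therefore carries inverses to inverses. -/
theorem fromBlocks_deriv_mul {R N : Type*} [CommRing R] [Differential R] [Fintype N]
    [DecidableEq N] {M M' : Matrix N N R} (h : M * M' = 1) :
    Matrix.fromBlocks M (M.map fun y => y′) 0 M *
      Matrix.fromBlocks M' (M'.map fun y => y′) 0 M' = 1 := by
  have h0 : M * M'.map (fun y => y′) + M.map (fun y => y′) * M' = 0 := by
    rw [add_comm, ← map_deriv_mul, h]
    ext a b
    rw [Matrix.map_apply, Matrix.one_apply]
    split_ifs <;> simp
  rw [Matrix.fromBlocks_multiply]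
  simp [h, h0]

end Matrices

section DeltaAdjoin

variable {K R : Type*} [CommRing K] [CommRing R] [Algebra K R] [Differential R] {s : Set R}

theorem subset_deltaAdjoin : s ⊆ deltaAdjoin K s := fun _ hx =>
  Algebra.mem_sInf.2 fun _ hS => hS.1 hx

theorem deriv_mem_deltaAdjoin {x : R} (hx : x ∈ deltaAdjoin K s) : x′ ∈ deltaAdjoin K s :=
  Algebra.mem_sInf.2 fun S hS => hS.2 x (Algebra.mem_sInf.1 hx S hS)

theorem deltaAdjoin_le {S : Subalgebra K R} (hs : s ⊆ S) (hd : ∀ x ∈ S, x′ ∈ S) :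
    deltaAdjoin K s ≤ S :=
  sInf_le ⟨hs, hd⟩

end DeltaAdjoin

section Jets

variable {m : ℕ} {L : Type*} [Field L] [SDRing L] (X : Matrix (Fin m) (Fin m) L)

/-- The generators `X, …, X⁽ⁿ⁾, det(X)⁻¹`. -/
abbrev jetGens (n : ℕ) : Set L := jetEntries X n ∪ {(X.det)⁻¹}

variable {X}

theorem jetGens_mono {n p : ℕ} (h : n ≤ p) : jetGens X n ⊆ jetGens X p := by
  rintro x (⟨j, hj, a, b, rfl⟩ | hx)
  · exact Or.inl ⟨j, hj.trans h, a, b, rfl⟩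
  · exact Or.inr hx

theorem apply_mem_jetGens (n : ℕ) (a b : Fin m) : X a b ∈ jetGens X n :=
  Or.inl ⟨0, n.zero_le, a, b, rfl⟩

theorem deriv_det_inv_mem {S : Type*} [SetLike S L] [SubringClass S L] {P : S} {n : ℕ}
    (hP : jetGens X (n + 1) ⊆ P) : ((X.det)⁻¹)′ ∈ P := by
  have hX : ∀ a b, X a b ∈ P := fun a b => hP (apply_mem_jetGens _ a b)
  have hX' : ∀ a b, (X a b)′ ∈ P := fun a b => hP (Or.inl ⟨1, by omega, a, b, rfl⟩)
  have hdet : (X.det)′ ∈ P := by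
    rw [Matrix.det_apply, map_sum]
    refine sum_mem fun σ _ => ?_
    rw [Units.smul_def, map_zsmul]
    refine zsmul_mem ?_ _
    have : ∀ t : Finset (Fin m),
        (∏ i ∈ t, X (σ i) i) ∈ P ∧ (∏ i ∈ t, X (σ i) i)′ ∈ P := by
      intro t
      induction t using Finset.induction with
      | empty => simp
      | insert a t ha ih =>
        rw [Finset.prod_insert ha, Derivation.leibniz, smul_eq_mul, smul_eq_mul]
        exact ⟨mul_mem (hX _ _) ih.1,
          add_mem (mul_mem (hX _ _) ih.2) (mul_mem ih.1 (hX' _ _))⟩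
    exact (this _).2
  rw [Derivation.leibniz_inv, smul_eq_mul]
  have hinv : (X.det)⁻¹ ∈ P := hP (Or.inr rfl)
  exact mul_mem (neg_mem (pow_mem hinv 2)) hdet

theorem deriv_jetGens_mem {S : Type*} [SetLike S L] [SubringClass S L] {P : S} {n : ℕ}
    (hP : jetGens X (n + 1) ⊆ P) {x : L} (hx : x ∈ jetGens X n) : x′ ∈ P := by
  rcases hx with ⟨j, hj, a, b, rfl⟩ | rfl
  · refine hP (Or.inl ⟨j + 1, by omega, a, b, ?_⟩)
    rw [Function.iterate_succ_apply']
  · exact deriv_det_inv_mem hP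

/-- Integer coefficients make the conclusion hold inside any subring containing the jets, whatever
its field of scalars. -/
theorem deriv_mem_adjoin_int {n : ℕ} {x : L} (hx : x ∈ Algebra.adjoin ℤ (jetGens X n)) :
    x′ ∈ Algebra.adjoin ℤ (jetGens X (n + 1)) := by
  have hmono := Algebra.adjoin_mono (R := ℤ) (jetGens_mono (X := X) n.le_succ)
  induction hx using Algebra.adjoin_induction with
  | mem x hx => exact deriv_jetGens_mem Algebra.subset_adjoin hx
  | algebraMap c => rw [Derivation.map_algebraMap]; exact zero_mem _
  | add x y _ _ hx hy => rw [map_add]; exact add_mem hx hy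
  | mul x y hx' hy' hx hy =>
    rw [Derivation.leibniz, smul_eq_mul, smul_eq_mul]
    exact add_mem (mul_mem (hmono hx') hy) (mul_mem (hmono hy') hx)

variable {k : Type*} [Field k] [SDRing k] [Algebra k L] [SDAlgebra k L]

/-- The prolonged equation satisfied by the jets of a fundamental matrix. -/
theorem exists_prolongation (hdet : X.det ≠ 0) (A : GL (Fin m) k)
    (hA : X.map sigma = A.val.map (algebraMap k L) * X) (n : ℕ) :
    ∃ (N : Type) (_ : Fintype N) (_ : DecidableEq N) (Y W : Matrix N N L) (B B' : Matrix N N k),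
      W * Y = 1 ∧ B' * B = 1 ∧ Y.map sigma = B.map (algebraMap k L) * Y ∧
      (∀ a b, Y a b ∈ Algebra.adjoin ℤ (jetGens X n)) ∧
      (∀ a b, W a b ∈ Algebra.adjoin ℤ (jetGens X n)) ∧
      (∀ x ∈ jetEntries X n, ∃ a b, x = Y a b) ∧ ∀ a b, ∃ c d, X⁻¹ a b = W c d := by
  induction n with
  | zero =>
    refine ⟨Fin m, inferInstance, inferInstance, X, X⁻¹, A.val, A⁻¹.val,
      Matrix.nonsing_inv_mul _ hdet.isUnit, A.inv_mul, hA, ?_, ?_, ?_, fun a b => ⟨a, b, rfl⟩⟩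
    · exact fun a b => Algebra.subset_adjoin (apply_mem_jetGens _ a b)
    · exact inv_apply_mem (fun a b => Algebra.subset_adjoin (apply_mem_jetGens _ a b))
        (Algebra.subset_adjoin (Or.inr rfl))
    · rintro x ⟨j, hj, a, b, rfl⟩
      obtain rfl : j = 0 := by omega
      exact ⟨a, b, rfl⟩
  | succ n ih =>
    obtain ⟨N, _, _, Y, W, B, B', hWY, hBB, hB, hY, hW, hjet, hinv⟩ := ih
    have hmono := Algebra.adjoin_mono (R := ℤ) (jetGens_mono (X := X) n.le_succ)
    have hblock : ∀ M : Matrix N N L, (∀ a b, M a b ∈ Algebra.adjoin ℤ (jetGens X n)) →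
        ∀ a b, Matrix.fromBlocks M (M.map fun y => y′) 0 M a b ∈
          Algebra.adjoin ℤ (jetGens X (n + 1)) := by
      rintro M hM (a | a) (b | b)
      · exact hmono (hM a b)
      · exact deriv_mem_adjoin_int (hM a b)
      · exact zero_mem _
      · exact hmono (hM a b)
    -- Differentiating `σ(Y) = BY` gives `σ(Y′) = B′Y + BY′` (primes here are derivatives), the
    -- upper right block of the prolonged equation.
    refine ⟨N ⊕ N, inferInstance, inferInstance, Matrix.fromBlocks Y (Y.map fun y => y′) 0 Y,
      Matrix.fromBlocks W (W.map fun y => y′) 0 W, Matrix.fromBlocks B (B.map fun y => y′) 0 B,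
      Matrix.fromBlocks B' (B'.map fun y => y′) 0 B',
      fromBlocks_deriv_mul hWY, fromBlocks_deriv_mul hBB, ?_,
      hblock Y hY, hblock W hW, ?_, ?_⟩
    · have h1 : (Y.map fun y => y′).map sigma = (Y.map sigma).map fun y => y′ := by
        ext a b
        exact sigma_deriv (Y a b)
      have h2 : (B.map fun y => y′).map (algebraMap k L) =
          (B.map (algebraMap k L)).map fun y => y′ := by
        ext a b
        exact (deriv_algebraMap (B a b)).symm
      have h3 : (0 : Matrix N N k).map (algebraMap k L) = 0 := Matrix.map_zero _ (map_zero _)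
      have h4 : (0 : Matrix N N L).map (sigma : L ≃+* L) = 0 := Matrix.map_zero _ (map_zero _)
      rw [Matrix.fromBlocks_map, Matrix.fromBlocks_map, Matrix.fromBlocks_multiply, h1, h2, h3, h4,
        hB, map_deriv_mul]
      simp [add_comm]
    · rintro x ⟨j, hj, a, b, rfl⟩
      rcases j with _ | j
      · obtain ⟨c, d, h⟩ := hjet _ ⟨0, n.zero_le, a, b, rfl⟩
        exact ⟨Sum.inl c, Sum.inl d, h⟩
      · obtain ⟨c, d, h⟩ := hjet _ ⟨j, by omega, a, b, rfl⟩
        -- A jet of order `j + 1` is the derivative of an entry of `Y`, found in the upper right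
        -- block.
        refine ⟨Sum.inl c, Sum.inr d, ?_⟩
        rw [Function.iterate_succ_apply', h]
        rfl
    · intro a b
      obtain ⟨c, d, h⟩ := hinv a b
      exact ⟨Sum.inl c, Sum.inl d, h⟩

end Jets

/-! ### Stability of `K_n`, `kC_E` and `F_n` under `σ` and `σ⁻¹`. -/

section Stability

variable {m : ℕ} {k L : Type*} [Field k] [Field L] [Algebra k L]
  {X : Matrix (Fin m) (Fin m) L}

/-- Stated for ring homomorphisms because `σ` is only semilinear over `k`. -/
theorem map_mem_of_mem_adjoin {s : Set L} {E : IntermediateField k L} (τ : L →+* L)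
    (hk : ∀ a : k, τ (algebraMap k L a) ∈ E) (hs : ∀ x ∈ s, τ x ∈ E) {x : L}
    (hx : x ∈ IntermediateField.adjoin k s) : τ x ∈ E := by
  induction hx using IntermediateField.adjoin_induction with
  | mem x hx => exact hs x hx
  | algebraMap c => exact hk c
  | add x y _ _ hx hy => rw [map_add]; exact add_mem hx hy
  | inv x _ hx => rw [map_inv₀]; exact inv_mem hx
  | mul x y _ _ hx hy => rw [map_mul]; exact mul_mem hx hy

variable [SDRing L]

theorem deriv_mem_of_mem_adjoin [SDRing k] [SDAlgebra k L] {s : Set L} {E : IntermediateField k L}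
    (hs : s ⊆ E) (hd : ∀ x ∈ s, x′ ∈ E) {x : L} (hx : x ∈ IntermediateField.adjoin k s) :
    x′ ∈ E := by
  have hle : IntermediateField.adjoin k s ≤ E := IntermediateField.adjoin_le_iff.2 hs
  induction hx using IntermediateField.adjoin_induction with
  | mem x hx => exact hd x hx
  | algebraMap c => rw [deriv_algebraMap]; exact E.algebraMap_mem _
  | add x y _ _ hx hy => rw [map_add]; exact add_mem hx hy
  | inv x hx' hx =>
    rw [Derivation.leibniz_inv, smul_eq_mul]
    exact mul_mem (neg_mem (pow_mem (inv_mem (hle hx')) 2)) hx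
  | mul x y hx' hy' hx hy =>
    rw [Derivation.leibniz, smul_eq_mul, smul_eq_mul]
    exact add_mem (mul_mem (hle hx') hy) (mul_mem (hle hy') hx)

theorem jetField_mono {n p : ℕ} (h : n ≤ p) : jetField k X n ≤ jetField k X p :=
  IntermediateField.adjoin.mono k _ _ (jetGens_mono h)

theorem baseConst_mono {E E' : IntermediateField k L} (h : E ≤ E') : baseConst E ≤ baseConst E' :=
  IntermediateField.adjoin.mono k _ _ fun _ hx => ⟨h hx.1, hx.2⟩

theorem baseConst_le (E : IntermediateField k L) : baseConst E ≤ E :=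
  IntermediateField.adjoin_le_iff.2 fun _ hx => hx.1

theorem mem_jetRing_of_mem_baseConst {n : ℕ} {x : L} (hx : x ∈ baseConst (jetField k X n)) :
    x ∈ jetRing k X n :=
  (jetRing k X n).algebraMap_mem ⟨x, hx⟩

theorem jetGens_subset_jetRing (n : ℕ) : jetGens X n ⊆ jetRing k X n := Algebra.subset_adjoin

theorem adjoin_int_subset_jetRing {n : ℕ} {x : L} (hx : x ∈ Algebra.adjoin ℤ (jetGens X n)) :
    x ∈ jetRing k X n := by
  have : Algebra.adjoin ℤ (jetGens X n) ≤ (jetRing k X n).restrictScalars ℤ :=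
    Algebra.adjoin_le (jetGens_subset_jetRing n)
  exact this hx

theorem adjoin_subset_jetRing {n : ℕ} {x : L} (hx : x ∈ Algebra.adjoin k (jetGens X n)) :
    x ∈ jetRing k X n := by
  have : Algebra.adjoin k (jetGens X n) ≤ (jetRing k X n).restrictScalars k :=
    Algebra.adjoin_le (jetGens_subset_jetRing n)
  exact this hx

theorem adjoin_subset_jetField {n : ℕ} {x : L} (hx : x ∈ Algebra.adjoin k (jetGens X n)) :
    x ∈ jetField k X n :=
  IntermediateField.algebra_adjoin_le_adjoin k _ hx

theorem jetRing_subset_jetField {n : ℕ} {x : L} (hx : x ∈ jetRing k X n) : x ∈ jetField k X n := by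
  induction hx using Algebra.adjoin_induction with
  | mem x hx => exact IntermediateField.subset_adjoin k _ hx
  | algebraMap c => exact baseConst_le _ c.2
  | add x y _ _ hx hy => exact add_mem hx hy
  | mul x y _ _ hx hy => exact mul_mem hx hy

theorem jetRing_mono {n p : ℕ} (h : n ≤ p) {x : L} (hx : x ∈ jetRing k X n) :
    x ∈ jetRing k X p := by
  induction hx using Algebra.adjoin_induction with
  | mem x hx => exact jetGens_subset_jetRing p (jetGens_mono h hx)
  | algebraMap c => exact mem_jetRing_of_mem_baseConst (baseConst_mono (jetField_mono h) c.2)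
  | add x y _ _ hx hy => exact add_mem hx hy
  | mul x y _ _ hx hy => exact mul_mem hx hy

/-- An endomorphism of `L` which fixes the `σ`-constants, preserves `k`, commutes with the
derivation and multiplies `X` by an invertible matrix over `k`. -/
structure IsLinearTwist (X : Matrix (Fin m) (Fin m) L) (k : Type*) [Field k] [Algebra k L]
    (τ : L →+* L) : Prop where
  map_const : ∀ x, sigma x = x → τ x = x
  map_base : ∀ a : k, ∃ b : k, τ (algebraMap k L a) = algebraMap k L b
  map_deriv : ∀ x, τ (x′) = ((τ x)′)
  map_matrix : ∃ M : GL (Fin m) k, X.map τ = M.val.map (algebraMap k L) * X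

namespace IsLinearTwist

/-- At order 0, `τ` multiplies `X` by a matrix over `k`. Since `τ` commutes with the derivation and
`(cy)′ = cy′ + c′y`, each derivative raises the order of a `k`-combination of jets by at most one.
-/
theorem map_jetEntries_mem [SDRing k] [SDAlgebra k L] {τ : L →+* L}
    (h : IsLinearTwist X k τ) {n : ℕ} {x : L}
    (hx : x ∈ jetEntries X n) : τ x ∈ Submodule.span k (jetEntries X n) := by
  obtain ⟨j, hj, a, b, rfl⟩ := hx
  have hmono : ∀ {i j : ℕ}, i ≤ j → jetEntries X i ⊆ jetEntries X j := by
    rintro i j hij _ ⟨l, hl, a, b, rfl⟩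
    exact ⟨l, hl.trans hij, a, b, rfl⟩
  refine Submodule.span_mono (hmono hj) ?_
  clear hj
  induction j with
  | zero =>
    obtain ⟨M, hM⟩ := h.map_matrix
    have : τ (X a b) = ∑ c, M.val a c • X c b := by
      have := congrFun (congrFun hM a) b
      rw [Matrix.map_apply, Matrix.mul_apply] at this
      rw [this]
      exact Finset.sum_congr rfl fun c _ => (Algebra.smul_def _ _).symm
    change τ (X a b) ∈ _
    rw [this]
    exact sum_mem fun c _ => Submodule.smul_mem _ _ (Submodule.subset_span ⟨0, le_rfl, c, b, rfl⟩)
  | succ j ih =>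
    rw [Function.iterate_succ_apply', h.map_deriv]
    generalize τ ((fun y : L => y′)^[j] (X a b)) = y at ih
    induction ih using Submodule.span_induction with
    | mem x hx =>
      obtain ⟨l, hl, c, d, rfl⟩ := hx
      refine Submodule.subset_span ⟨l + 1, by omega, c, d, ?_⟩
      rw [Function.iterate_succ_apply']
    | zero => rw [map_zero]; exact zero_mem _
    | add x y _ _ hx hy => rw [map_add]; exact add_mem hx hy
    | smul c x hx' hx =>
      rw [Algebra.smul_def, Derivation.leibniz, deriv_algebraMap, smul_eq_mul, smul_eq_mul,
        ← Algebra.smul_def, mul_comm, ← Algebra.smul_def]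
      exact add_mem (Submodule.smul_mem _ _ hx)
        (Submodule.smul_mem _ _ (Submodule.span_mono (hmono j.le_succ) hx'))

theorem map_jetGens_mem [SDRing k] [SDAlgebra k L] {τ : L →+* L}
    (h : IsLinearTwist X k τ) {n : ℕ} {x : L}
    (hx : x ∈ jetGens X n) : τ x ∈ Algebra.adjoin k (jetGens X n) := by
  rcases hx with hx | rfl
  · exact Algebra.span_le_adjoin k _
      (Submodule.span_mono Set.subset_union_left (h.map_jetEntries_mem hx))
  · obtain ⟨M, hM⟩ := h.map_matrix
    have : τ ((X.det)⁻¹) = algebraMap k L (M.val.det)⁻¹ * (X.det)⁻¹ := by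
      have h1 : τ X.det = algebraMap k L M.val.det * X.det := by
        rw [RingHom.map_det, RingHom.map_det, ← Matrix.det_mul]
        exact congrArg Matrix.det hM
      rw [map_inv₀, h1, mul_inv, map_inv₀]
    rw [this]
    exact mul_mem (Subalgebra.algebraMap_mem _ _) (Algebra.subset_adjoin (Or.inr rfl))

theorem map_jetField_mem [SDRing k] [SDAlgebra k L] {τ : L →+* L}
    (h : IsLinearTwist X k τ) {n : ℕ} {x : L}
    (hx : x ∈ jetField k X n) : τ x ∈ jetField k X n := by
  refine map_mem_of_mem_adjoin τ (fun a => ?_)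
    (fun x hx => adjoin_subset_jetField (h.map_jetGens_mem hx)) hx
  obtain ⟨b, hb⟩ := h.map_base a
  rw [hb]
  exact IntermediateField.algebraMap_mem _ _

theorem map_baseConst_mem {τ : L →+* L} (h : IsLinearTwist X k τ) {E : IntermediateField k L}
    {x : L} (hx : x ∈ baseConst E) : τ x ∈ baseConst E := by
  refine map_mem_of_mem_adjoin τ (fun a => ?_) (fun x hx => ?_) hx
  · obtain ⟨b, hb⟩ := h.map_base a
    rw [hb]
    exact IntermediateField.algebraMap_mem _ _
  · rw [h.map_const x hx.2]
    exact IntermediateField.subset_adjoin k _ hx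

theorem map_jetRing_mem [SDRing k] [SDAlgebra k L] {τ : L →+* L}
    (h : IsLinearTwist X k τ) {n : ℕ} {x : L}
    (hx : x ∈ jetRing k X n) : τ x ∈ jetRing k X n := by
  induction hx using Algebra.adjoin_induction with
  | mem x hx => exact adjoin_subset_jetRing (h.map_jetGens_mem hx)
  | algebraMap c => exact mem_jetRing_of_mem_baseConst (h.map_baseConst_mem c.2)
  | add x y _ _ hx hy => rw [map_add]; exact add_mem hx hy
  | mul x y _ _ hx hy => rw [map_mul]; exact mul_mem hx hy

end IsLinearTwist

end Stability

end SigmaDelta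

/-! ### Exhaustion of `L`, `kC_L` and `R` by the finite-order levels. -/

namespace SigmaDelta
open SDRing

section Union

variable {m : ℕ} {k L : Type*} [Field k] [Field L] [SDRing L] [Algebra k L]
  {X : Matrix (Fin m) (Fin m) L}

theorem jetRing_subset_pvRing {n : ℕ} {x : L} (hx : x ∈ jetRing k X n) : x ∈ pvRing k X := by
  induction hx using Algebra.adjoin_induction with
  | mem x hx =>
    rcases hx with ⟨j, -, a, b, rfl⟩ | h
    · induction j with
      | zero => exact subset_deltaAdjoin (Or.inl ⟨a, b, rfl⟩)
      | succ j ih =>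
        rw [Function.iterate_succ_apply']
        exact deriv_mem_deltaAdjoin ih
    · exact subset_deltaAdjoin (Or.inr h)
  | algebraMap c =>
    exact (pvRing k X).algebraMap_mem
      ⟨c.1, baseConst_mono (show jetField k X n ≤ ⊤ from le_top) c.2⟩
  | add x y _ _ hx hy => exact add_mem hx hy
  | mul x y _ _ hx hy => exact mul_mem hx hy

variable [SDRing k] [SDAlgebra k L]

/-- The derivation maps `K_n` into `K_{n+1}`, so the union of this chain is a `δ`-stable field
containing the generators. -/
theorem iSup_jetField (hgen : deltaFieldAdjoin k (entries X ∪ {(X.det)⁻¹}) = ⊤) (x : L) :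
    ∃ n, x ∈ jetField k X n := by
  have hdir : Directed (· ≤ ·) (jetField k X) :=
    Monotone.directed_le fun _ _ h => jetField_mono h
  have hmem : ∀ y : L, y ∈ (⨆ n, jetField k X n) ↔ ∃ n, y ∈ jetField k X n := fun y => by
    rw [← SetLike.mem_coe, IntermediateField.coe_iSup_of_directed hdir]
    simp
  rw [← hmem]
  have : deltaFieldAdjoin k (entries X ∪ {(X.det)⁻¹}) ≤ ⨆ n, jetField k X n := by
    refine sInf_le ⟨?_, fun y hy => ?_⟩
    · refine Set.Subset.trans ?_ ((IntermediateField.subset_adjoin k _).trans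
        (le_iSup (jetField k X) 0))
      rintro _ (⟨a, b, rfl⟩ | h)
      · exact apply_mem_jetGens 0 a b
      · exact Or.inr h
    · obtain ⟨n, hn⟩ := (hmem y).1 hy
      exact (hmem _).2 ⟨n + 1, deriv_mem_of_mem_adjoin
        ((jetGens_mono n.le_succ).trans (IntermediateField.subset_adjoin k _))
        (fun z hz => deriv_jetGens_mem (IntermediateField.subset_adjoin k _) hz) hn⟩
  exact this (hgen ▸ IntermediateField.mem_top)

theorem exists_mem_baseConst (hgen : deltaFieldAdjoin k (entries X ∪ {(X.det)⁻¹}) = ⊤) {x : L}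
    (hx : x ∈ kCL k L) : ∃ n, x ∈ baseConst (jetField k X n) := by
  have hdir : Directed (· ≤ ·) fun n => baseConst (jetField k X n) :=
    Monotone.directed_le fun _ _ h => baseConst_mono (jetField_mono h)
  have hmem : ∀ y : L, y ∈ (⨆ n, baseConst (jetField k X n)) ↔
      ∃ n, y ∈ baseConst (jetField k X n) := fun y => by
    rw [← SetLike.mem_coe, IntermediateField.coe_iSup_of_directed hdir]
    simp
  rw [← hmem]
  refine (IntermediateField.adjoin_le_iff.2 fun y hy => ?_ :
    kCL k L ≤ ⨆ n, baseConst (jetField k X n)) hx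
  obtain ⟨n, hn⟩ := iSup_jetField hgen y
  exact (hmem y).2 ⟨n, IntermediateField.subset_adjoin k _ ⟨hn, hy.2⟩⟩

theorem deriv_mem_kCL {x : L} (hx : x ∈ kCL k L) : x′ ∈ kCL k L := by
  refine deriv_mem_of_mem_adjoin (IntermediateField.subset_adjoin k _) (fun y hy => ?_) hx
  exact IntermediateField.subset_adjoin k _
    ⟨IntermediateField.mem_top, by rw [sigma_deriv, hy.2]⟩

theorem exists_deriv_mem_jetRing (hgen : deltaFieldAdjoin k (entries X ∪ {(X.det)⁻¹}) = ⊤) {n : ℕ}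
    {x : L} (hx : x ∈ jetRing k X n) : ∃ p, x′ ∈ jetRing k X p := by
  induction hx using Algebra.adjoin_induction with
  | mem x hx => exact ⟨n + 1, deriv_jetGens_mem (jetGens_subset_jetRing _) hx⟩
  | algebraMap c =>
    -- The derivative of a scalar need not stay over the same base: it is located in `kC_L`, hence
    -- at some level `p`.
    obtain ⟨p, hp⟩ := exists_mem_baseConst hgen
      (deriv_mem_kCL (baseConst_mono (show jetField k X n ≤ ⊤ from le_top) c.2))
    exact ⟨p, mem_jetRing_of_mem_baseConst hp⟩
  | add x y _ _ hx hy =>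
    obtain ⟨p, hp⟩ := hx
    obtain ⟨q, hq⟩ := hy
    rw [map_add]
    exact ⟨max p q, add_mem (jetRing_mono (le_max_left _ _) hp)
      (jetRing_mono (le_max_right _ _) hq)⟩
  | mul x y hx' hy' hx hy =>
    obtain ⟨p, hp⟩ := hx
    obtain ⟨q, hq⟩ := hy
    rw [Derivation.leibniz, smul_eq_mul, smul_eq_mul]
    have h1 : n ≤ max n (max p q) := le_max_left _ _
    have h2 : p ≤ max n (max p q) := (le_max_left _ _).trans (le_max_right _ _)
    have h3 : q ≤ max n (max p q) := (le_max_right _ _).trans (le_max_right _ _)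
    exact ⟨max n (max p q), add_mem (mul_mem (jetRing_mono h1 hx') (jetRing_mono h3 hq))
      (mul_mem (jetRing_mono h1 hy') (jetRing_mono h2 hp))⟩

theorem mem_pvRing_iff (hgen : deltaFieldAdjoin k (entries X ∪ {(X.det)⁻¹}) = ⊤) {x : L} :
    x ∈ pvRing k X ↔ ∃ n, x ∈ jetRing k X n := by
  refine ⟨fun hx => ?_, fun ⟨n, hn⟩ => jetRing_subset_pvRing hn⟩
  let U : Subalgebra (kCL k L) L :=
    { carrier := {x | ∃ n, x ∈ jetRing k X n}
      mul_mem' := fun {a b} ⟨p, hp⟩ ⟨q, hq⟩ => ⟨max p q, mul_mem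
        (jetRing_mono (le_max_left _ _) hp) (jetRing_mono (le_max_right _ _) hq)⟩
      add_mem' := fun {a b} ⟨p, hp⟩ ⟨q, hq⟩ => ⟨max p q, add_mem
        (jetRing_mono (le_max_left _ _) hp) (jetRing_mono (le_max_right _ _) hq)⟩
      algebraMap_mem' := fun c => by
        obtain ⟨n, hn⟩ := exists_mem_baseConst hgen c.2
        exact ⟨n, mem_jetRing_of_mem_baseConst hn⟩ }
  have hle : pvRing k X ≤ U := by
    refine deltaAdjoin_le ?_ fun y ⟨n, hn⟩ => exists_deriv_mem_jetRing hgen hn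
    rintro _ (⟨a, b, rfl⟩ | h)
    · exact ⟨0, jetGens_subset_jetRing 0 (apply_mem_jetGens 0 a b)⟩
    · exact ⟨0, jetGens_subset_jetRing 0 (Or.inr h)⟩
  exact hle hx

end Union

/-! ### Simplicity of `F_n` and `R`, and the Picard–Vessiot property. -/

section Generic

variable {m : ℕ} {k L : Type*} [Field k] [SDRing k] [Field L] [SDRing L] [Algebra k L]
  {A : GL (Fin m) k} {X : Matrix (Fin m) (Fin m) L}

namespace IsGenericSolutionField

theorem det_ne_zero (h : IsGenericSolutionField k L A X) : X.det ≠ 0 := by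
  have hind : AlgebraicIndependent k fun p : Fin m × Fin m => X p.1 p.2 :=
    h.indeterminates.comp (fun p => (0, p)) (Prod.mk_right_injective 0)
  have hX : (Matrix.mvPolynomialX (Fin m) (Fin m) k).map
      (MvPolynomial.aeval fun p : Fin m × Fin m => X p.1 p.2) = X := by
    ext a b
    simp [Matrix.mvPolynomialX_apply]
  have hdet : MvPolynomial.aeval (fun p : Fin m × Fin m => X p.1 p.2)
      (Matrix.mvPolynomialX (Fin m) (Fin m) k).det = X.det := by
    rw [AlgHom.map_det]
    exact congrArg Matrix.det hX
  rw [← hdet]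
  exact fun h0 => Matrix.det_mvPolynomialX_ne_zero (Fin m) k
    ((map_eq_zero_iff _ hind).1 h0)

theorem isLinearTwist_sigma (h : IsGenericSolutionField k L A X) :
    IsLinearTwist X k ((sigma : L ≃+* L) : L →+* L) where
  map_const _ hx := hx
  map_base a := ⟨sigma a, h.extends_base.sigma_algebraMap a⟩
  map_deriv := sigma_deriv
  map_matrix := ⟨A, h.equation⟩

theorem isLinearTwist_sigma_symm (h : IsGenericSolutionField k L A X) :
    IsLinearTwist X k ((sigma : L ≃+* L).symm : L →+* L) where
  map_const x hx := (sigma : L ≃+* L).symm_apply_eq.2 hx.symm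
  map_base a := ⟨sigma.symm a, (sigma : L ≃+* L).symm_apply_eq.2 (by
    rw [h.extends_base.sigma_algebraMap, RingEquiv.apply_symm_apply])⟩
  map_deriv x := (sigma : L ≃+* L).symm_apply_eq.2 (by
    rw [sigma_deriv]
    exact congrArg _ ((sigma : L ≃+* L).apply_symm_apply x).symm)
  map_matrix := by
    -- Apply `σ⁻¹` to `X = A⁻¹σ(X)`: the matrix is `σ⁻¹(A⁻¹)`.
    refine ⟨(Matrix.GeneralLinearGroup.map ((sigma : k ≃+* k).symm : k →+* k)) A⁻¹, ?_⟩
    have h1 : X = (A⁻¹.val.map (algebraMap k L)) * X.map (sigma : L ≃+* L) := by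
      rw [h.equation, ← mul_assoc, ← Matrix.map_mul, A.inv_mul,
        Matrix.map_one _ (map_zero _) (map_one _), one_mul]
    have h2 : X.map (sigma : L ≃+* L).symm =
        ((A⁻¹.val.map (algebraMap k L)) * X.map (sigma : L ≃+* L)).map (sigma : L ≃+* L).symm := by
      rw [← h1]
    have h3 : (A⁻¹.val.map (algebraMap k L)).map (sigma : L ≃+* L).symm =
        (A⁻¹.val.map (sigma : k ≃+* k).symm).map (algebraMap k L) := by
      ext a b
      refine (sigma : L ≃+* L).symm_apply_eq.2 ?_
      simp only [Matrix.map_apply]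
      rw [h.extends_base.sigma_algebraMap, RingEquiv.apply_symm_apply]
    rw [Matrix.map_mul, h3] at h2
    refine h2.trans ?_
    congr 1
    ext a b
    simp

theorem isSigmaStable_jetRing (h : IsGenericSolutionField k L A X) (n : ℕ) :
    IsSigmaStable (jetRing k X n) := by
  have := h.extends_base
  exact fun x hx => ⟨h.isLinearTwist_sigma.map_jetRing_mem hx,
    h.isLinearTwist_sigma_symm.map_jetRing_mem hx⟩

theorem isSDStable_kCL (h : IsGenericSolutionField k L A X) : IsSDStable (kCL k L) := by
  have := h.extends_base
  exact ⟨fun x hx => ⟨h.isLinearTwist_sigma.map_baseConst_mem hx,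
    h.isLinearTwist_sigma_symm.map_baseConst_mem hx⟩, fun x hx => deriv_mem_kCL hx⟩

theorem isSDStable_pvRing (h : IsGenericSolutionField k L A X) : IsSDStable (pvRing k X) := by
  have := h.extends_base
  refine ⟨fun x hx => ?_, fun x hx => deriv_mem_deltaAdjoin hx⟩
  obtain ⟨n, hn⟩ := (mem_pvRing_iff h.generates).1 hx
  exact ⟨jetRing_subset_pvRing (h.isSigmaStable_jetRing n x hn).1,
    jetRing_subset_pvRing (h.isSigmaStable_jetRing n x hn).2⟩

theorem isSimpleSigmaRing_jetRing (h : IsGenericSolutionField k L A X) (n : ℕ) :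
    IsSimpleSigmaRing (restrictSigma (jetRing k X n) (h.isSigmaStable_jetRing n)) := by
  have := h.extends_base
  refine ⟨inferInstance, fun q hq => or_iff_not_imp_right.2 fun hq1 => ?_⟩
  obtain ⟨N, _, _, Y, W, B, B', hWY, hBB, hB, hY, hW, hjet, hinv⟩ :=
    exists_prolongation h.det_ne_zero A h.equation n
  let E := jetField k X n
  let K := baseConst E
  let F := jetRing k X n
  let C : Subfield K := (sigmaConst L).comap K.val.toRingHom
  have hKE : K ≤ E := baseConst_le E
  have hσE : IsSigmaStable E := fun x hx => ⟨h.isLinearTwist_sigma.map_jetField_mem hx,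
    h.isLinearTwist_sigma_symm.map_jetField_mem hx⟩
  have hσK : IsSigmaStable K := fun x hx => ⟨h.isLinearTwist_sigma.map_baseConst_mem hx,
    h.isLinearTwist_sigma_symm.map_baseConst_mem hx⟩
  let _ : Algebra K E := (IntermediateField.inclusion hKE).toRingHom.toAlgebra
  let ι : F →ₐ[K] E :=
    { toFun := fun x => ⟨x.1, jetRing_subset_jetField x.2⟩
      map_one' := rfl
      map_mul' := fun _ _ => rfl
      map_zero' := rfl
      map_add' := fun _ _ => rfl
      commutes' := fun _ => rfl }
  let Y₀ : Matrix N N F := fun a b => ⟨Y a b, adjoin_int_subset_jetRing (hY a b)⟩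
  let W₀ : Matrix N N F := fun a b => ⟨W a b, adjoin_int_subset_jetRing (hW a b)⟩
  have hinj : Function.Injective fun M : Matrix N N F => M.map F.val :=
    Matrix.map_injective Subtype.val_injective
  refine sigmaIdeal_eq_bot (C := C) (K := K) (E := E) (restrictSigma K hσK : K →+* K)
    (restrictSigma E hσE : E →+* E) (restrictSigma F (h.isSigmaStable_jetRing n) : F →+* F)
    (fun _ => rfl) (fun _ => rfl) (fun c => Subtype.ext c.2) (fun x hx => ?_) ι
    (fun x y hxy => Subtype.ext (congrArg (fun z : E => z.1) hxy)) (fun _ => rfl)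
    (Y := Y₀) (W := W₀) ?_ ?_ (B := B.map (algebraMap k F)) (B' := B'.map (algebraMap k F)) ?_ ?_
    (fun a b => ⟨algebraMap k K (B' a b), rfl⟩) q hq hq1
  -- A constant of `K_n` lies in `kC_{K_n}` by construction; this is why the compositum is taken as
  -- base field.
  · have hx' : sigma x.1 = x.1 := congrArg Subtype.val hx
    exact ⟨⟨⟨x.1, IntermediateField.subset_adjoin k _ ⟨x.2, hx'⟩⟩, hx'⟩, rfl⟩
  · apply hinj
    simp only [Matrix.map_mul]
    rw [Matrix.map_one _ (map_zero _) (map_one _)]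
    exact hWY
  · set P : Subalgebra K L := (Algebra.adjoin K
      ({x | ∃ a b, x = Y₀ a b} ∪ {x | ∃ a b, x = W₀ a b})).map F.val with hP
    have hYP : ∀ a b, Y a b ∈ P := fun a b =>
      ⟨Y₀ a b, Algebra.subset_adjoin (Or.inl ⟨a, b, rfl⟩), rfl⟩
    have hWP : ∀ a b, W a b ∈ P := fun a b =>
      ⟨W₀ a b, Algebra.subset_adjoin (Or.inr ⟨a, b, rfl⟩), rfl⟩
    have hle : F ≤ P := by
      refine Algebra.adjoin_le ?_
      rintro x (hx | rfl)
      · obtain ⟨a, b, rfl⟩ := hjet x hx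
        exact hYP a b
      -- The generator `det(X)⁻¹` is recovered as `det(X⁻¹)`, since the entries of `X⁻¹` occur in
      -- `W`.
      · have : X⁻¹.det ∈ P := det_mem fun a b => by
          obtain ⟨c, d, hcd⟩ := hinv a b
          rw [hcd]
          exact hWP c d
        rwa [Matrix.det_nonsing_inv, Ring.inverse_eq_inv'] at this
    rw [eq_top_iff]
    intro x _
    obtain ⟨y, hy, hyx⟩ := hle x.2
    rwa [← Subtype.ext (a1 := y) (a2 := x) hyx]
  · rw [← Matrix.map_mul, hBB, Matrix.map_one _ (map_zero _) (map_one _)]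
  · apply hinj
    simp only [Matrix.map_mul]
    exact hB

theorem isSimpleSigmaRing_pvRing (h : IsGenericSolutionField k L A X) :
    IsSimpleSigmaRing (restrictSigma (pvRing k X) h.isSDStable_pvRing.1) := by
  have := h.extends_base
  refine ⟨inferInstance, fun q hq => or_iff_not_imp_right.2 fun hq1 => ?_⟩
  rw [eq_bot_iff]
  intro x hx
  obtain ⟨n, hn⟩ := (mem_pvRing_iff h.generates).1 x.2
  let inc : jetRing k X n →+* pvRing k X :=
    { toFun := fun y => ⟨y.1, jetRing_subset_pvRing y.2⟩
      map_one' := rfl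
      map_mul' := fun _ _ => rfl
      map_zero' := rfl
      map_add' := fun _ _ => rfl }
  -- The trace of `q` on the level containing `x` is zero or everything: either `x = 0`, or `1 ∈ q`.
  rcases (h.isSimpleSigmaRing_jetRing n).2 (q.comap inc) (fun y hy => hq (inc y) hy) with h0 | h0
  · have hmem : (⟨x.1, hn⟩ : jetRing k X n) ∈ q.comap inc := hx
    rw [h0, Ideal.mem_bot] at hmem
    exact Subtype.ext (congrArg (fun z : jetRing k X n => z.1) hmem)
  · refine absurd ((Ideal.eq_top_iff_one q).2 ?_) hq1
    have hmem : (1 : jetRing k X n) ∈ q.comap inc := h0 ▸ Submodule.mem_top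
    exact hmem

theorem isPicardVessiot_pvRing (h : IsGenericSolutionField k L A X) :
    letI : SDRing (kCL k L) := restrictSD (kCL k L) h.isSDStable_kCL
    letI : SDRing (pvRing k X) := restrictSD (pvRing k X) h.isSDStable_pvRing
    IsPicardVessiot (kCL k L) (pvRing k X)
      (Matrix.GeneralLinearGroup.map (algebraMap k (kCL k L)) A) := by
  let : SDRing (kCL k L) := restrictSD (kCL k L) h.isSDStable_kCL
  let : SDRing (pvRing k X) := restrictSD (pvRing k X) h.isSDStable_pvRing
  have hXR : ∀ a b, X a b ∈ pvRing k X := fun a b => subset_deltaAdjoin (Or.inl ⟨a, b, rfl⟩)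
  have hdR : (X.det)⁻¹ ∈ pvRing k X := subset_deltaAdjoin (Or.inr rfl)
  have hinj : Function.Injective fun M : Matrix (Fin m) (Fin m) (pvRing k X) =>
      M.map (pvRing k X).val := Matrix.map_injective Subtype.val_injective
  let Z₀ : Matrix (Fin m) (Fin m) (pvRing k X) := fun a b => ⟨X a b, hXR a b⟩
  let Z₁ : Matrix (Fin m) (Fin m) (pvRing k X) := fun a b => ⟨X⁻¹ a b, inv_apply_mem hXR hdR a b⟩
  let Z : GL (Fin m) (pvRing k X) :=
    { val := Z₀
      inv := Z₁
      val_inv := by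
        apply hinj
        simp only [Matrix.map_mul]
        rw [Matrix.map_one _ (map_zero _) (map_one _)]
        exact Matrix.mul_nonsing_inv X h.det_ne_zero.isUnit
      inv_val := by
        apply hinj
        simp only [Matrix.map_mul]
        rw [Matrix.map_one _ (map_zero _) (map_one _)]
        exact Matrix.nonsing_inv_mul X h.det_ne_zero.isUnit }
  have hdet : ((((Matrix.GeneralLinearGroup.det Z)⁻¹ : (pvRing k X)ˣ) : pvRing k X) : L) =
      (X.det)⁻¹ := by
    have h1 : (pvRing k X).val Z₀.det = X.det := by
      rw [AlgHom.map_det]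
      rfl
    refine eq_inv_of_mul_eq_one_left ?_
    rw [← h1]
    exact congrArg Subtype.val (Matrix.GeneralLinearGroup.det Z).inv_mul
  refine ⟨{ deriv_algebraMap := fun _ => rfl, sigma_algebraMap := fun _ => rfl },
    ⟨inferInstance, fun I hI _ => h.isSimpleSigmaRing_pvRing.2 I hI⟩, Z, ?_, ?_⟩
  · apply hinj
    simp only [Matrix.map_mul]
    exact h.equation
  · rw [eq_top_iff]
    intro x _
    refine Algebra.mem_sInf.2 fun S hS => ?_
    -- `R` is minimal among `δ`-stable subalgebras of `L`, while `S` lives inside `R`; its image in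
    -- `L` allows minimality to be used.
    have hle : pvRing k X ≤ S.map (pvRing k X).val := by
      refine deltaAdjoin_le ?_ ?_
      · rintro _ (⟨a, b, rfl⟩ | hx)
        · exact ⟨Z₀ a b, hS.1 (Or.inl ⟨a, b, rfl⟩), rfl⟩
        · rw [Set.mem_singleton_iff] at hx
          exact ⟨_, hS.1 (Or.inr rfl), hdet.trans hx.symm⟩
      · rintro _ ⟨y, hy, rfl⟩
        exact ⟨y′, hS.2 y hy, rfl⟩
    obtain ⟨y, hy, hyx⟩ := hle x.2
    rwa [← Subtype.ext (a1 := y) (a2 := x) hyx]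

end IsGenericSolutionField

end Generic

end SigmaDelta

/-! ### Existence of the generic solution field. -/

namespace SigmaDelta
open SDRing

section Derivations

/-- Derivations of a ring into itself. -/
abbrev SelfDerivation (R : Type*) [CommRing R] := Derivation ℤ R R

/-- The derivation attached to a section `R → R[ε]` of the projection from dual numbers. -/
def derivationOfDual {R : Type*} [CommRing R] (ψ : R →+* DualNumber R)
    (hψ : ∀ x, (ψ x).fst = x) : SelfDerivation R :=
  Derivation.mk' (AddMonoidHom.toIntLinearMap
    (AddMonoidHom.mk' (fun x => (ψ x).snd) fun x y => by rw [map_add, TrivSqZeroExt.snd_add]))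
    fun x y => by
      change (ψ (x * y)).snd = x * (ψ y).snd + y * (ψ x).snd
      rw [map_mul, DualNumber.snd_mul, hψ, hψ]
      ring

/-- The ring homomorphism `a ↦ f a + f (D a) ε` to dual numbers. -/
def dualOfDerivation {R S : Type*} [CommRing R] [CommRing S] (f : R →+* S) (D : SelfDerivation R) :
    R →+* DualNumber S where
  toFun a := TrivSqZeroExt.inl (f a) + TrivSqZeroExt.inr (f (D a))
  map_one' := by ext <;> simp
  map_zero' := by ext <;> simp
  map_add' a b := by ext <;> simp
  map_mul' a b := by ext <;> simp [mul_comm]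

@[simp]
theorem fst_dualOfDerivation {R S : Type*} [CommRing R] [CommRing S] (f : R →+* S)
    (D : SelfDerivation R) (a : R) : (dualOfDerivation f D a).fst = f a := by
  simp [dualOfDerivation]

@[simp]
theorem snd_dualOfDerivation {R S : Type*} [CommRing R] [CommRing S] (f : R →+* S)
    (D : SelfDerivation R) (a : R) : (dualOfDerivation f D a).snd = f (D a) := by
  change (TrivSqZeroExt.inl (f a) + TrivSqZeroExt.inr (f (D a)) : DualNumber S).snd = _
  rw [TrivSqZeroExt.snd_add, TrivSqZeroExt.snd_inl, TrivSqZeroExt.snd_inr, zero_add]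

/-- Derivations correspond to ring sections of the projection from dual numbers, and a homomorphism
out of a polynomial ring may be prescribed on coefficients and variables. -/
theorem exists_derivation_mvPolynomial {R ι : Type*} [CommRing R] (D : SelfDerivation R)
    (g : ι → MvPolynomial ι R) :
    ∃ D' : SelfDerivation (MvPolynomial ι R),
      (∀ a, D' (MvPolynomial.C a) = MvPolynomial.C (D a)) ∧ ∀ i, D' (MvPolynomial.X i) = g i := by
  let ψ : MvPolynomial ι R →+* DualNumber (MvPolynomial ι R) :=
    MvPolynomial.eval₂Hom (dualOfDerivation MvPolynomial.C D)
      fun i => TrivSqZeroExt.inl (MvPolynomial.X i) + TrivSqZeroExt.inr (g i)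
  have hC : ∀ a, ψ (MvPolynomial.C a) =
      TrivSqZeroExt.inl (MvPolynomial.C a) + TrivSqZeroExt.inr (MvPolynomial.C (D a)) :=
    fun a => MvPolynomial.eval₂Hom_C _ _ _
  have hX : ∀ i, ψ (MvPolynomial.X i) =
      TrivSqZeroExt.inl (MvPolynomial.X i) + TrivSqZeroExt.inr (g i) :=
    fun i => MvPolynomial.eval₂Hom_X' _ _ _
  have hψ : ∀ x, (ψ x).fst = x := by
    intro x
    induction x using MvPolynomial.induction_on with
    | C a => rw [hC]; simp
    | add p q hp hq => rw [map_add, TrivSqZeroExt.fst_add, hp, hq]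
    | mul_X p i hp => rw [map_mul, TrivSqZeroExt.fst_mul, hp, hX]; simp
  refine ⟨derivationOfDual ψ hψ, fun a => ?_, fun i => ?_⟩
  · change (ψ _).snd = _
    rw [hC]
    simp
  · change (ψ _).snd = _
    rw [hX]
    simp

/-- A dual number is a unit as soon as its first component is, so the section extends to the
localisation. -/
theorem exists_derivation_fractionRing {R L : Type*} [CommRing R] [Field L] [Algebra R L]
    [IsFractionRing R L] (D : SelfDerivation R) :
    ∃ D' : SelfDerivation L, ∀ a, D' (algebraMap R L a) = algebraMap R L (D a) := by
  have hunit : ∀ y : nonZeroDivisors R, IsUnit (dualOfDerivation (algebraMap R L) D y) := by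
    intro y
    rw [TrivSqZeroExt.isUnit_iff_isUnit_fst]
    rw [fst_dualOfDerivation]
    exact IsLocalization.map_units L y
  let ψ : L →+* DualNumber L := IsLocalization.lift hunit
  have hψa : ∀ a, ψ (algebraMap R L a) = dualOfDerivation (algebraMap R L) D a :=
    IsLocalization.lift_eq hunit
  have hψ : ∀ x, (ψ x).fst = x := by
    have : (TrivSqZeroExt.fstHom L L L : DualNumber L →+* L).comp ψ = RingHom.id L := by
      refine IsLocalization.ringHom_ext (nonZeroDivisors R) (RingHom.ext fun a => ?_)
      change (ψ (algebraMap R L a)).fst = algebraMap R L a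
      rw [hψa, fst_dualOfDerivation]
    exact fun x => RingHom.congr_fun this x
  refine ⟨derivationOfDual ψ hψ, fun a => ?_⟩
  change (ψ _).snd = _
  rw [hψa, snd_dualOfDerivation]

end Derivations

section Twist

variable {k : Type*} [Field k] {m : ℕ}
  (D : SelfDerivation (MvPolynomial (ℕ × Fin m × Fin m) k))

/-- The matrix of differential indeterminates. -/
noncomputable def indetMatrix (k : Type*) [Field k] (m : ℕ) :
    Matrix (Fin m) (Fin m) (MvPolynomial (ℕ × Fin m × Fin m) k) :=
  fun a b => MvPolynomial.X (0, a, b)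

/-- The matrix `M X`, for the matrix `X` of differential indeterminates. -/
noncomputable def scaledIndetMatrix (M : Matrix (Fin m) (Fin m) k) :
    Matrix (Fin m) (Fin m) (MvPolynomial (ℕ × Fin m × Fin m) k) :=
  M.map MvPolynomial.C * indetMatrix k m

/-- The endomorphism of differential polynomials which extends `τ` and sends the `j`-th derivative
of `X` to the `j`-th derivative of `M X`. -/
noncomputable def twistHom (τ : k →+* k) (M : Matrix (Fin m) (Fin m) k) :
    MvPolynomial (ℕ × Fin m × Fin m) k →+* MvPolynomial (ℕ × Fin m × Fin m) k :=
  MvPolynomial.eval₂Hom (MvPolynomial.C.comp τ)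
    fun p => D^[p.1] ((scaledIndetMatrix M) p.2.1 p.2.2)

variable {D}

theorem twistHom_C (τ : k →+* k) (M : Matrix (Fin m) (Fin m) k) (a : k) :
    twistHom D τ M (MvPolynomial.C a) = MvPolynomial.C (τ a) :=
  MvPolynomial.eval₂Hom_C _ _ _

theorem twistHom_X (τ : k →+* k) (M : Matrix (Fin m) (Fin m) k) (p : ℕ × Fin m × Fin m) :
    twistHom D τ M (MvPolynomial.X p) =
      D^[p.1] ((scaledIndetMatrix M) p.2.1 p.2.2) :=
  MvPolynomial.eval₂Hom_X' _ _ _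

theorem twistHom_indetMatrix (τ : k →+* k) (M : Matrix (Fin m) (Fin m) k) :
    (indetMatrix k m).map (twistHom D τ M) = scaledIndetMatrix M := by
  ext1 a b
  exact twistHom_X τ M (0, a, b)

theorem iterate_deriv_indetMatrix
    (hDX : ∀ p : ℕ × Fin m × Fin m, D (MvPolynomial.X p) = MvPolynomial.X (p.1 + 1, p.2))
    (j : ℕ) (a b : Fin m) :
    D^[j] (indetMatrix k m a b) = MvPolynomial.X (j, a, b) := by
  induction j with
  | zero => rfl
  | succ j ih => rw [Function.iterate_succ_apply', ih, hDX]

theorem twistHom_deriv [SDRing k]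
    (hDC : ∀ a : k, D (MvPolynomial.C a) = MvPolynomial.C (a′))
    (hDX : ∀ p : ℕ × Fin m × Fin m, D (MvPolynomial.X p) = MvPolynomial.X (p.1 + 1, p.2))
    {τ : k →+* k} (hτ : ∀ a, τ (a′) = ((τ a)′)) (M : Matrix (Fin m) (Fin m) k)
    (x : MvPolynomial (ℕ × Fin m × Fin m) k) :
    twistHom D τ M (D x) = D (twistHom D τ M x) := by
  induction x using MvPolynomial.induction_on with
  | C a => rw [hDC, twistHom_C, twistHom_C, hDC, hτ]
  | add p q hp hq => simp only [map_add, hp, hq]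
  | mul_X p i hp =>
    have hi : twistHom D τ M (D (MvPolynomial.X i)) = D (twistHom D τ M (MvPolynomial.X i)) := by
      rw [hDX, twistHom_X, twistHom_X, Function.iterate_succ_apply']
    simp only [Derivation.leibniz, smul_eq_mul, map_add, map_mul, hp, hi]

/-- At order 0, `MX` goes to `τ'(M) M' X = X`. Higher orders follow because twists commute with `D`.
-/
theorem twistHom_twistHom [SDRing k]
    (hDC : ∀ a : k, D (MvPolynomial.C a) = MvPolynomial.C (a′))
    (hDX : ∀ p : ℕ × Fin m × Fin m, D (MvPolynomial.X p) = MvPolynomial.X (p.1 + 1, p.2))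
    {τ τ' : k →+* k} (hτ' : ∀ a, τ' (a′) = ((τ' a)′))
    (hττ : ∀ a, τ' (τ a) = a) {M M' : Matrix (Fin m) (Fin m) k} (hM : M.map τ' * M' = 1)
    (x : MvPolynomial (ℕ × Fin m × Fin m) k) :
    twistHom D τ' M' (twistHom D τ M x) = x := by
  have hX : (scaledIndetMatrix M).map (twistHom D τ' M') = indetMatrix k m := by
    have h1 : (M.map (MvPolynomial.C : k →+* MvPolynomial (ℕ × Fin m × Fin m) k)).map
        (twistHom D τ' M') = (M.map τ').map MvPolynomial.C := by
      ext1 a b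
      exact twistHom_C τ' M' (M a b)
    rw [scaledIndetMatrix, Matrix.map_mul, h1, twistHom_indetMatrix, scaledIndetMatrix, ← mul_assoc,
      ← Matrix.map_mul, hM,
      Matrix.map_one _ (map_zero _) (map_one _), one_mul]
  have hiter : ∀ (j : ℕ) y, twistHom D τ' M' (D^[j] y) = D^[j] (twistHom D τ' M' y) := by
    intro j y
    induction j with
    | zero => rfl
    | succ j ih =>
      rw [Function.iterate_succ_apply', Function.iterate_succ_apply',
        twistHom_deriv hDC hDX hτ', ih]
  induction x using MvPolynomial.induction_on with
  | C a => rw [twistHom_C, twistHom_C, hττ]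
  | add p q hp hq => rw [map_add, map_add, hp, hq]
  | mul_X p i hp =>
    rw [map_mul, map_mul, hp, twistHom_X, hiter]
    congr 1
    refine (congrArg _ (congrFun (congrFun hX i.2.1) i.2.2)).trans ?_
    exact iterate_deriv_indetMatrix hDX _ _ _

end Twist

theorem exists_isGenericSolutionField {k : Type u} [Field k] [SDRing k] {m : ℕ}
    (A : GL (Fin m) k) :
    ∃ (L : Type u) (_ : Field L) (_ : SDRing L) (_ : Algebra k L) (X : Matrix (Fin m) (Fin m) L),
      IsGenericSolutionField k L A X := by
  obtain ⟨D, hDC, hDX'⟩ := exists_derivation_mvPolynomial (Differential.deriv (R := k))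
    fun p : ℕ × Fin m × Fin m => (MvPolynomial.X (p.1 + 1, p.2) : MvPolynomial _ k)
  let P := MvPolynomial (ℕ × Fin m × Fin m) k
  let L := FractionRing P
  obtain ⟨DL, hDL'⟩ := exists_derivation_fractionRing (L := L) D
  have hDL (x : P) : DL (algebraMap P L x) = algebraMap P L (D x) := hDL' x
  have hDX (p : ℕ × Fin m × Fin m) :
      D (MvPolynomial.X p : P) = (MvPolynomial.X (p.1 + 1, p.2) : P) :=
    hDX' p
  let σ : k →+* k := (sigma : k ≃+* k)
  let τ : k →+* k := (sigma : k ≃+* k).symm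
  have hσ : ∀ a, σ (a′) = ((σ a)′) := sigma_deriv
  have hτ : ∀ a, τ (a′) = ((τ a)′) := fun a => (sigma : k ≃+* k).symm_apply_eq.2 (by
    rw [sigma_deriv]
    exact congrArg _ ((sigma : k ≃+* k).apply_symm_apply a).symm)
  have hστ : ∀ a, σ (τ a) = a := (sigma : k ≃+* k).apply_symm_apply
  have hτσ : ∀ a, τ (σ a) = a := (sigma : k ≃+* k).symm_apply_apply
  -- The inverse of the twist by `σ` and `A` must send `X` to `σ⁻¹(A⁻¹)X`.
  let M' : Matrix (Fin m) (Fin m) k := A⁻¹.val.map τ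
  have h1 : A.val.map τ * M' = 1 := by
    rw [← Matrix.map_mul, A.mul_inv, Matrix.map_one _ (map_zero _) (map_one _)]
  have h2 : M'.map σ * A.val = 1 := by
    have : M'.map σ = A⁻¹.val := by
      ext a b
      exact hστ _
    rw [this, A.inv_mul]
  let e : P ≃+* P :=
    { twistHom D σ A.val with
      invFun := twistHom D τ M'
      left_inv := twistHom_twistHom hDC hDX hτ hτσ h1
      right_inv := twistHom_twistHom hDC hDX hσ hστ h2 }
  let eL : L ≃+* L := IsFractionRing.ringEquivOfRingEquiv e
  have heL : ∀ x : P, eL (algebraMap P L x) = algebraMap P L (twistHom D σ A.val x) := fun x =>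
    IsFractionRing.ringEquivOfRingEquiv_algebraMap e x
  have hcomm : ∀ x, eL (DL x) = DL (eL x) := by
    intro x
    -- By the quotient rule, commutation on fractions reduces to commutation on polynomials.
    obtain ⟨a, b, -, rfl⟩ := IsFractionRing.div_surjective (A := P) x
    simp only [Derivation.leibniz_div, smul_eq_mul, map_mul, map_sub, map_pow, map_inv₀, map_div₀,
      hDL, heL, twistHom_deriv hDC hDX hσ]
  let _ : SDRing L := { deriv := DL, sigma := eL, sigma_deriv := hcomm }
  have hderiv : ∀ x : L, x′ = DL x := fun _ => rfl
  have hkL : ∀ a : k, algebraMap k L a = algebraMap P L (MvPolynomial.C a) := fun a =>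
    IsScalarTower.algebraMap_apply k P L a
  have hiter : ∀ p : ℕ × Fin m × Fin m, (fun y : L => y′)^[p.1]
      (algebraMap P L (MvPolynomial.X (0, p.2))) = algebraMap P L (MvPolynomial.X p) := by
    rintro ⟨j, q⟩
    induction j with
    | zero => rfl
    | succ j ih =>
      rw [Function.iterate_succ_apply']
      refine (congrArg (fun y : L => y′) ih).trans ?_
      change DL _ = _
      rw [hDL, hDX]
  refine ⟨L, inferInstance, inferInstance, inferInstance,
    (indetMatrix k m).map (algebraMap P L), ?_, ?_, ?_, ?_⟩
  · refine { deriv_algebraMap := fun a => ?_, sigma_algebraMap := fun a => ?_ }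
    · rw [hkL, hkL, hderiv, hDL, hDC]
    · rw [hkL, hkL]
      change eL _ = _
      rw [heL, twistHom_C]
      rfl
  · have hfun : (fun p : ℕ × Fin m × Fin m => (fun y : L => y′)^[p.1]
        ((indetMatrix k m).map (algebraMap P L) p.2.1 p.2.2)) =
        fun p => algebraMap P L (MvPolynomial.X p) := funext hiter
    rw [hfun]
    exact (MvPolynomial.algebraicIndependent_X (ℕ × Fin m × Fin m) k).map'
      (f := Algebra.algHom k P L) (IsFractionRing.injective P L)
  · rw [eq_top_iff]
    intro x _
    have hmem : ∀ (S : IntermediateField k L), entries ((indetMatrix k m).map (algebraMap P L)) ⊆ S →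
        (∀ y ∈ S, y′ ∈ S) → x ∈ S := by
      intro S hS hd
      have hXS : ∀ p, algebraMap P L (MvPolynomial.X p) ∈ S := by
        intro p
        rw [← hiter p]
        generalize p.1 = j
        induction j with
        | zero => exact hS ⟨p.2.1, p.2.2, rfl⟩
        | succ j ih =>
          rw [Function.iterate_succ_apply']
          exact hd _ ih
      have hPS : ∀ y : P, algebraMap P L y ∈ S := by
        intro y
        induction y using MvPolynomial.induction_on with
        | C a => rw [← hkL]; exact S.algebraMap_mem a
        | add p q hp hq => rw [map_add]; exact add_mem hp hq
        | mul_X p i hp => rw [map_mul]; exact mul_mem hp (hXS i)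
      obtain ⟨a, b, -, rfl⟩ := IsFractionRing.div_surjective (A := P) x
      exact div_mem (hPS a) (hPS b)
    exact (IntermediateField.mem_sInf).2
      fun S hS => hmem S (Set.subset_union_left.trans hS.1) hS.2
  · ext a b
    have := congrFun (congrFun (twistHom_indetMatrix (D := D) σ A.val) a) b
    change eL (algebraMap P L _) = _
    rw [heL]
    refine (congrArg (algebraMap P L) this).trans ?_
    rw [scaledIndetMatrix, Matrix.mul_apply, Matrix.mul_apply, map_sum]
    refine Finset.sum_congr rfl fun c _ => ?_
    rw [map_mul, Matrix.map_apply, Matrix.map_apply, Matrix.map_apply, hkL]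

end SigmaDelta

open SigmaDelta in
theorem mainTheorem1 {k : Type u} [Field k] [CharZero k] [SDRing k]
    (hk : sigmaConstAlg k = (sigmaConst k : Set k)) {m : ℕ} (A : GL (Fin m) k) :
    -- the field `L` with the prescribed `σ` and derivation exists
    (∃ (L : Type u) (_ : Field L) (_ : SDRing L) (_ : Algebra k L) (X : Matrix (Fin m) (Fin m) L),
      IsGenericSolutionField k L A X) ∧
    -- and every such `L` has the stated properties
    ∀ (L : Type v) [Field L] [SDRing L] [Algebra k L] (X : Matrix (Fin m) (Fin m) L),
      IsGenericSolutionField k L A X →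
        (∃ (hK : IsSDStable (kCL k L)) (hR : IsSDStable (pvRing k X)),
          letI : SDRing (kCL k L) := restrictSD (kCL k L) hK
          letI : SDRing (pvRing k X) := restrictSD (pvRing k X) hR
          IsPicardVessiot (kCL k L) (pvRing k X)
              (Matrix.GeneralLinearGroup.map (algebraMap k (kCL k L)) A) ∧
            IsSimpleSigmaRing (SDRing.sigma : pvRing k X ≃+* pvRing k X)) ∧
        (∀ n : ℕ, ∃ hF : IsSigmaStable (jetRing k X n),
          IsSimpleSigmaRing (restrictSigma (jetRing k X n) hF)) ∧
        (pvRing k X : Set L) = ⋃ n : ℕ, (jetRing k X n : Set L) := by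
  refine ⟨exists_isGenericSolutionField A, fun L _ _ _ X h => ⟨⟨h.isSDStable_kCL,
    h.isSDStable_pvRing, h.isPicardVessiot_pvRing, h.isSimpleSigmaRing_pvRing⟩,
    fun n => ⟨h.isSigmaStable_jetRing n, h.isSimpleSigmaRing_jetRing n⟩, ?_⟩⟩
  have := h.extends_base
  ext x
  rw [SetLike.mem_coe, mem_pvRing_iff h.generates, Set.mem_iUnion]
  rfl
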